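/- Let $K$ be a real quadratic field with real embeddings $\iota_1\neq\iota_2$, let $\theta\in K\smallsetminus\mathbb Q$, let $L=\mathbb Z+\mathbb Z\theta$, and let $\Lambda=(\iota_1,\iota_2)(L)\subset\mathbb R^2$. Write $\theta$ and $\theta'$ also for the real numbers $\iota_1(\theta)$ and $\iota_2(\theta)$. Let $U_L^+$ be the group of units $w\in O_K^*$ with $wL\subset L$ and $\iota_1(w),\iota_2(w)>0$, acting on $\Lambda$ by $w\cdot(x,y)=(\iota_1(w)x,\iota_2(w)y)$. Let $V=\epsilon^{\mathbb Z}$ be a nontrivial (equivalently, finite index) subgroup of $U_L^+$ with generator $\epsilon$, and let $S(\Lambda,V)=\Lambda\rtimes V$. For a discrete group $\Gamma$ and a multiplier $\sigma:\Gamma\times\Gamma\to U(1)$, let $C^*(\Gamma,\sigma)$ be the C*-algebra generated by the operators $(R^\sigma_\gamma f)(x)=f(x\gamma)\,\sigma(x,\gamma)$ on $\ell^2(\Gamma)$. For $t,u\in\mathbb R$ let $\sigma_t((n,m),(k,r))=e^{\pi i t(nr-mk)}$ on $\mathbb Z^2$ and $\sigma_u(\lambda,\eta)=e^{\pi i u\,\lambda\wedge\eta}$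 on $\Lambda$, where $(a,b)\wedge(c,d)=ad-bc$. On a semidirect product $N\rtimes G$, where $N$ carries a multiplier $\sigma$, put $\tilde\sigma((x,g),(y,h))=\sigma(x,g\cdot y)$. Let $\mathcal A_t$ be the noncommutative torus, i.e. the universal C*-algebra generated by unitaries $U_0,V_0$ with $V_0U_0=e^{2\pi i t}U_0V_0$, and put $U_{(n,m)}=e^{-\pi i tnm}V_0^nU_0^m$. Crossed products are the full crossed products. Then there is $\varphi_\epsilon=\begin{pmatrix}a&b\\c&d\end{pmatrix}\in SL_2(\mathbb Z)$ with $\epsilon=a+b\theta$ and $\epsilon\theta=c+d\theta$. Let $\mathbb Z^2\rtimes_{\varphi_\epsilon}\mathbb Z$ be formed with the action $k\cdot x=x\varphi_\epsilon^k$ on row vectors. Let $\theta_1=\theta$, $\theta_2=\theta'$, $i\in\{1,2\}$, and $u_i=\theta_i(\theta'-\theta)^{-1}$. Denote by $\mathbb T_{\Lambda,i}=\mathcal A_{\theta_i}$ the noncommutative torus with real multiplication. There are actions by $*$-automorphisms, all denoted $\upsilon_i$: - of $V$ on $\mathbb T_{\Lambda,i}$, with $\upsilon_i(\epsilon^k)(U_x)=U_{x\varphi_\epsilon^k}$;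 - of $\mathbb Z$ on $C^*(\mathbb Z^2,\sigma_{\theta_i})$, with $\upsilon_i^k(R_x)=R_{x\varphi_\epsilon^k}$; - of $V$ on $C^*(\Lambda,\sigma_{u_i})$, with $\upsilon_i(w)(R_\lambda)=R_{w\cdot\lambda}$. Moreover, there are $*$-isomorphisms $$\mathbb T_{\Lambda,i}\rtimes_{\upsilon_i} V\;\cong\; C^*(\mathbb Z^2,\sigma_{\theta_i})\rtimes_{\upsilon_i}\mathbb Z\;\cong\; C^*(\mathbb Z^2\rtimes_{\varphi_\epsilon}\mathbb Z,\tilde\sigma_{\theta_i})\;\cong\; C^*(\Lambda,\sigma_{u_i})\rtimes_{\upsilon_i}V\;\cong\; C^*(S(\Lambda,V),\tilde\sigma_{u_i}).$$ -/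

import Mathlib

open scoped ENNReal NumberField

noncomputable section

/-! ## C*-algebras generated inside a bounded product -/

/-- The bounded (`ℓ^∞`) product of nonzero unital C*-algebras is a unital C*-algebra. -/
instance boundedProductCStarAlgebra {J : Type*} {B : J → Type*} [∀ j, CStarAlgebra (B j)]
    [∀ j, Nontrivial (B j)] : CStarAlgebra (lp B ∞) where

/-- The C*-subalgebra (with unit) of a C*-algebra generated by a subset. -/
def generatedCStar {A : Type*} [CStarAlgebra A] (s : Set A) : StarSubalgebra ℂ A :=
  (StarAlgebra.adjoin ℂ s).topologicalClosure

instance generatedCStar_isClosed {A : Type*} [CStarAlgebra A] (s : Set A) :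
    IsClosed (generatedCStar s : Set A) :=
  StarSubalgebra.isClosed_topologicalClosure _

theorem mem_generatedCStar {A : Type*} [CStarAlgebra A] {s : Set A} {a : A} (ha : a ∈ s) :
    a ∈ generatedCStar s :=
  StarSubalgebra.le_topologicalClosure _ (StarAlgebra.subset_adjoin ℂ s ha)

/-! ## Full crossed products of unital C*-algebras by discrete groups -/

universe u v

/-- A covariant representation of `(A, G, α)`: a unital *-representation `π` of `A` and a unitary
representation `W` of `G` on a nonzero Hilbert space with `W g π(a) (W g)* = π(α g a)`. -/
structure CovariantRep {A : Type u} [CStarAlgebra A] {G : Type v} [Group G]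
    (α : G →* (A ≃⋆ₐ[ℂ] A)) where
  /-- the Hilbert space -/
  H : Type (max u v)
  [normed : NormedAddCommGroup H]
  [inner : InnerProductSpace ℂ H]
  [complete : CompleteSpace H]
  [nontrivial : Nontrivial H]
  /-- the representation of the algebra -/
  π : A →⋆ₐ[ℂ] (H →L[ℂ] H)
  /-- the representation of the group -/
  W : G →* unitary (H →L[ℂ] H)
  covariant : ∀ (g : G) (a : A),
    (W g : H →L[ℂ] H) * π a * star (W g : H →L[ℂ] H) = π (α g a)

attribute [instance] CovariantRep.normed CovariantRep.inner CovariantRep.complete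
  CovariantRep.nontrivial

namespace CovariantRep

variable {A : Type u} [CStarAlgebra A] {G : Type v} [Group G] (α : G →* (A ≃⋆ₐ[ℂ] A))

/-- The bounded product of all `B(H)`, over all covariant representations. -/
def Ambient : Type (max u v + 1) := lp (fun ρ : CovariantRep α => ρ.H →L[ℂ] ρ.H) ∞

instance : CStarAlgebra (Ambient α) :=
  inferInstanceAs (CStarAlgebra (lp (fun ρ : CovariantRep α => ρ.H →L[ℂ] ρ.H) ∞))

/-- The image of `a ∈ A` in the universal (direct sum) covariant representation. -/
def univπ (a : A) : Ambient α :=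
  ⟨fun ρ => ρ.π a, memℓp_infty ⟨‖a‖, by
    rintro _ ⟨ρ, rfl⟩
    exact NonUnitalStarAlgHom.norm_apply_le ρ.π a⟩⟩

/-- The image of `g ∈ G` in the universal (direct sum) covariant representation. -/
def univW (g : G) : Ambient α :=
  ⟨fun ρ => (ρ.W g : ρ.H →L[ℂ] ρ.H), memℓp_infty ⟨1, by
    rintro _ ⟨ρ, rfl⟩
    exact (CStarRing.norm_coe_unitary (ρ.W g)).le⟩⟩

end CovariantRep

/-- The (full) crossed product `A ⋊_α G` of a unital C*-algebra by an action of a discrete group: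
the C*-algebra generated by the images of `A` and `G` in the direct sum of all covariant
representations. -/
def CrossedProduct {A : Type u} [CStarAlgebra A] {G : Type v} [Group G]
    (α : G →* (A ≃⋆ₐ[ℂ] A)) : Type (max u v + 1) :=
  generatedCStar (Set.range (CovariantRep.univπ α) ∪ Set.range (CovariantRep.univW α))

instance crossedProductCStarAlgebra {A : Type u} [CStarAlgebra A] {G : Type v} [Group G]
    (α : G →* (A ≃⋆ₐ[ℂ] A)) : CStarAlgebra (CrossedProduct α) :=
  inferInstanceAs (CStarAlgebra (generatedCStar
    (Set.range (CovariantRep.univπ α) ∪ Set.range (CovariantRep.univW α))))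

/-! ## Twisted group C*-algebras -/

/-- The Hilbert space `ℓ²(Γ)`. -/
abbrev ell2 (Γ : Type*) : Type _ := lp (fun _ : Γ => ℂ) 2

/-- The operator `R^σ_γ` on `ℓ²(Γ)` given by `(R^σ_γ f)(x) = f(xγ) σ(x, γ)`. -/
def twistedTranslation {Γ : Type*} [Group Γ] (σ : Γ → Γ → Circle) (γ : Γ) :
    ell2 Γ →L[ℂ] ell2 Γ :=
  LinearMap.mkContinuous
    { toFun := fun f => ⟨fun x => f (x * γ) * (σ x γ : ℂ), by
        have hf := (memℓp_gen_iff (p := 2) (by norm_num)).1 (lp.memℓp f)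
        refine (memℓp_gen_iff (p := 2) (by norm_num)).2 ?_
        simpa only [norm_mul, Circle.norm_coe, mul_one, Function.comp_def, Equiv.coe_mulRight]
          using (Equiv.mulRight γ).summable_iff.2 hf⟩
      map_add' := fun f g => by
        ext x
        exact add_mul (f (x * γ)) (g (x * γ)) _
      map_smul' := fun c f => by
        ext x
        exact mul_assoc c (f (x * γ)) _ }
    1 (fun f => by
      rw [one_mul, lp.norm_eq_tsum_rpow (by norm_num), lp.norm_eq_tsum_rpow (by norm_num)]
      refine le_of_eq ?_
      congr 1
      simpa only [LinearMap.coe_mk, AddHom.coe_mk, norm_mul, Circle.norm_coe, mul_one,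
        Equiv.coe_mulRight] using (Equiv.mulRight γ).tsum_eq (fun x => ‖f x‖ ^ (2 : ℝ≥0∞).toReal))

/-- The twisted group C*-algebra `C*(Γ, σ)`: the norm closure of the algebra generated by the
operators `R^σ_γ` on `ℓ²(Γ)`. -/
def TwistedGroupCStar {Γ : Type*} [Group Γ] (σ : Γ → Γ → Circle) : Type _ :=
  generatedCStar (Set.range (twistedTranslation σ))

/-- `R^σ_γ` as an element of `C*(Γ, σ)`. -/
def TwistedGroupCStar.R {Γ : Type*} [Group Γ] (σ : Γ → Γ → Circle) (γ : Γ) :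
    TwistedGroupCStar σ :=
  ⟨twistedTranslation σ γ, mem_generatedCStar ⟨γ, rfl⟩⟩

instance twistedGroupCStarAlgebra {Γ : Type*} [Group Γ] (σ : Γ → Γ → Circle) :
    CStarAlgebra (TwistedGroupCStar σ) :=
  inferInstanceAs (CStarAlgebra (generatedCStar (Set.range (twistedTranslation σ))))

/-- The map `σ̃((x, g), (y, h)) = σ(x, g • y)` on a semidirect product `N ⋊ G`. -/
def semidirectTwist {N G : Type*} [Group N] [Group G] (act : G →* MulAut N)
    (σ : N → N → Circle) : (N ⋊[act] G) → (N ⋊[act] G) → Circle :=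
  fun a b => σ a.left (act a.right b.left)

/-! ## Noncommutative tori -/

/-- A pair of unitaries on a nonzero Hilbert space with `V U = e^{2πiθ} U V`. -/
structure RotationPair (θ : ℝ) where
  /-- the Hilbert space -/
  H : Type
  [normed : NormedAddCommGroup H]
  [inner : InnerProductSpace ℂ H]
  [complete : CompleteSpace H]
  [nontrivial : Nontrivial H]
  /-- the first unitary -/
  U : unitary (H →L[ℂ] H)
  /-- the second unitary -/
  V : unitary (H →L[ℂ] H)
  relation : (V * U : H →L[ℂ] H) =
    (Circle.exp (2 * Real.pi * θ) : ℂ) • (U * V : H →L[ℂ] H)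

attribute [instance] RotationPair.normed RotationPair.inner RotationPair.complete
  RotationPair.nontrivial

/-- The bounded product of all `B(H)`, over all pairs of unitaries as above. -/
def RotationPair.Ambient (θ : ℝ) : Type 1 := lp (fun ρ : RotationPair θ => ρ.H →L[ℂ] ρ.H) ∞

instance (θ : ℝ) : CStarAlgebra (RotationPair.Ambient θ) :=
  inferInstanceAs (CStarAlgebra (lp (fun ρ : RotationPair θ => ρ.H →L[ℂ] ρ.H) ∞))

/-- A family of unitaries gives a unitary of the bounded product. -/
def productUnitary {J : Type*} {B : J → Type*} [∀ j, CStarAlgebra (B j)]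
    [∀ j, Nontrivial (B j)] (w : ∀ j, unitary (B j)) : unitary (lp B ∞) :=
  ⟨⟨fun j => (w j : B j), memℓp_infty ⟨1, by
      rintro _ ⟨j, rfl⟩
      exact (CStarRing.norm_coe_unitary (w j)).le⟩⟩, by
    rw [Unitary.mem_iff]
    constructor
    · ext j
      simp
    · ext j
      simp⟩

/-- The universal unitary `U`. -/
def univU (θ : ℝ) : unitary (RotationPair.Ambient θ) :=
  productUnitary (fun ρ => ρ.U)

/-- The universal unitary `V`. -/
def univV (θ : ℝ) : unitary (RotationPair.Ambient θ) :=
  productUnitary (fun ρ => ρ.V)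

/-- The noncommutative torus `𝒜_θ`: the universal C*-algebra generated by two unitaries `U`, `V`
with `V U = e^{2πiθ} U V`, realized in the direct sum of all representations of the relation. -/
def NCTorus (θ : ℝ) : Type 1 :=
  generatedCStar {(univU θ : RotationPair.Ambient θ), (univV θ : RotationPair.Ambient θ)}

instance ncTorusCStarAlgebra (θ : ℝ) : CStarAlgebra (NCTorus θ) :=
  inferInstanceAs (CStarAlgebra (generatedCStar
    {(univU θ : RotationPair.Ambient θ), (univV θ : RotationPair.Ambient θ)}))

/-- The canonical generator `U` of `𝒜_θ`. -/
def NCTorus.U (θ : ℝ) : unitary (NCTorus θ) :=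
  ⟨⟨univU θ, mem_generatedCStar (Set.mem_insert _ _)⟩,
    Unitary.mem_iff.2 ⟨Subtype.ext (Unitary.coe_star_mul_self (univU θ)),
      Subtype.ext (Unitary.coe_mul_star_self (univU θ))⟩⟩

/-- The canonical generator `V` of `𝒜_θ`. -/
def NCTorus.V (θ : ℝ) : unitary (NCTorus θ) :=
  ⟨⟨univV θ, mem_generatedCStar (Set.mem_insert_of_mem _ (Set.mem_singleton _))⟩,
    Unitary.mem_iff.2 ⟨Subtype.ext (Unitary.coe_star_mul_self (univV θ)),
      Subtype.ext (Unitary.coe_mul_star_self (univV θ))⟩⟩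

/-- The group `ℤ²`, written multiplicatively; an element is a row vector `(n, m)`. -/
abbrev ZSq : Type := Multiplicative (Fin 2 → ℤ)

/-- The unitaries `U_{(n,m)} = e^{-πiθnm} V^n U^m` of `𝒜_θ`, which satisfy
`U_x U_y = σ_θ(x, y) U_{x+y}`. -/
def NCTorus.weyl (θ : ℝ) (x : ZSq) : NCTorus θ :=
  (Circle.exp (-(Real.pi * θ * x.toAdd 0 * x.toAdd 1)) : ℂ) •
    ((NCTorus.V θ ^ x.toAdd 0 * NCTorus.U θ ^ x.toAdd 1 : unitary (NCTorus θ)) : NCTorus θ)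

/-- The multiplier `σ_θ((n,m),(k,r)) = exp(πiθ(nr - mk))` on `ℤ²`. -/
def sigmaZ (θ : ℝ) (x y : ZSq) : Circle :=
  Circle.exp (Real.pi * θ * (x.toAdd 0 * y.toAdd 1 - x.toAdd 1 * y.toAdd 0))

/-- The right action `x ↦ x φ` of a matrix on row vectors, as an automorphism of `ℤ²`. -/
def rowAut (φ : Matrix.SpecialLinearGroup (Fin 2) ℤ) : MulAut ZSq where
  toFun x := .ofAdd (Matrix.vecMul x.toAdd φ.1)
  invFun x := .ofAdd (Matrix.vecMul x.toAdd (φ⁻¹).1)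
  left_inv x := by
    have h : φ.1 * (φ⁻¹).1 = 1 := congrArg Subtype.val (mul_inv_cancel φ)
    simp only [toAdd_ofAdd, Matrix.vecMul_vecMul, h, Matrix.vecMul_one, ofAdd_toAdd]
  right_inv x := by
    have h : (φ⁻¹).1 * φ.1 = 1 := congrArg Subtype.val (inv_mul_cancel φ)
    simp only [toAdd_ofAdd, Matrix.vecMul_vecMul, h, Matrix.vecMul_one, ofAdd_toAdd]
  map_mul' x y := by
    simp only [toAdd_mul, Matrix.add_vecMul, ofAdd_add]

/-- The action of `ℤ` on `ℤ²` by powers of `φ`, so that `k` acts by `x ↦ x φ^k`. -/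
def rowAction (φ : Matrix.SpecialLinearGroup (Fin 2) ℤ) : Multiplicative ℤ →* MulAut ZSq :=
  zpowersHom (MulAut ZSq) (rowAut φ)

/-! ## Lattices and units in a real quadratic field -/

section Lattice

variable {K : Type*} [Field K]

/-- The lattice `L = ℤ + ℤθ` in `K`. -/
def latticeL (θ : K) : AddSubgroup K := AddSubgroup.closure {1, θ}

/-- The elements of the ring of integers that preserve `L`. -/
def multiplierRing (θ : K) : Subalgebra ℤ (𝓞 K) where
  carrier := {x | ∀ l ∈ latticeL θ, (x : K) * l ∈ latticeL θ}
  mul_mem' := fun {x y} hx hy l hl => by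
    have := hx _ (hy l hl)
    simpa [mul_assoc] using this
  add_mem' := fun {x y} hx hy l hl => by
    have := (latticeL θ).add_mem (hx l hl) (hy l hl)
    simpa [add_mul] using this
  algebraMap_mem' := fun n l hl => by
    have := (latticeL θ).zsmul_mem hl n
    simpa using this

theorem inv_mul_mem_latticeL (θ : K) (w : (𝓞 K)ˣ)
    (hw : ∀ l ∈ latticeL θ, (w : K) * l ∈ latticeL θ) :
    ∀ l ∈ latticeL θ, ((w⁻¹ : (𝓞 K)ˣ) : K) * l ∈ latticeL θ := by
  have : Algebra.IsIntegral (multiplierRing θ) (𝓞 K) := Algebra.IsIntegral.tower_top ℤ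
  have hu : IsUnit (algebraMap (multiplierRing θ) (𝓞 K) ⟨(w : 𝓞 K), hw⟩) := w.isUnit
  obtain ⟨t, ht⟩ := isUnit_of_map_unit (algebraMap (multiplierRing θ) (𝓞 K)) _ hu
  have h1 : (w : 𝓞 K) * ((t⁻¹ : (multiplierRing θ)ˣ) : multiplierRing θ).1 = 1 := by
    have := congrArg Subtype.val (t.mul_inv)
    rw [ht] at this
    exact this
  have h2 : ((w⁻¹ : (𝓞 K)ˣ) : 𝓞 K) = ((t⁻¹ : (multiplierRing θ)ˣ) : multiplierRing θ).1 :=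
    Units.inv_eq_of_mul_eq_one_right h1
  intro l hl
  rw [h2]
  exact ((t⁻¹ : (multiplierRing θ)ˣ) : multiplierRing θ).2 l hl

/-- The group `U_L^+` of totally positive units `w` of `K` with `w L ⊆ L`. -/
def totallyPositiveUnits (ι : Fin 2 → K →+* ℝ) (θ : K) : Subgroup (𝓞 K)ˣ where
  carrier := {w | (∀ l ∈ latticeL θ, (w : K) * l ∈ latticeL θ) ∧ ∀ i, 0 < ι i (w : K)}
  one_mem' := by simp
  mul_mem' := fun {x y} hx hy => by
    refine ⟨fun l hl => ?_, fun i => ?_⟩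
    · have := hx.1 _ (hy.1 l hl)
      simpa [mul_assoc] using this
    · simpa using mul_pos (hx.2 i) (hy.2 i)
  inv_mem' := fun {x} hx => by
    refine ⟨inv_mul_mem_latticeL θ x hx.1, fun i => ?_⟩
    have h : ι i ((x⁻¹ : (𝓞 K)ˣ) : K) * ι i (x : K) = 1 := by
      rw [← map_mul, ← map_mul, Units.inv_mul, map_one, map_one]
    exact pos_of_mul_pos_left (h ▸ one_pos) (hx.2 i).le

/-- The embedding `ℓ ↦ (ι₁(ℓ), ι₂(ℓ))` of `K` into `ℝ²`. -/
def embR2 (ι : Fin 2 → K →+* ℝ) : K →+ ℝ × ℝ := (ι 0 : K →+ ℝ).prod (ι 1 : K →+ ℝ)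

/-- The lattice `Λ = (ι₁, ι₂)(L)` in `ℝ²`. -/
def latticeΛ (ι : Fin 2 → K →+* ℝ) (θ : K) : AddSubgroup (ℝ × ℝ) :=
  (latticeL θ).map (embR2 ι)

/-- The action `(x, y) ↦ (ι₁(w) x, ι₂(w) y)` of a totally positive unit `w` on `Λ`. -/
def unitMap (ι : Fin 2 → K →+* ℝ) (θ : K) (w : totallyPositiveUnits ι θ) (p : latticeΛ ι θ) :
    latticeΛ ι θ :=
  ⟨(ι 0 (w : (𝓞 K)ˣ) * p.1.1, ι 1 (w : (𝓞 K)ˣ) * p.1.2), by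
    obtain ⟨_, l, hl, rfl⟩ := p
    exact ⟨_, w.2.1 l hl, by simp [embR2]⟩⟩

theorem unitMap_mul (ι : Fin 2 → K →+* ℝ) (θ : K) (w z : totallyPositiveUnits ι θ)
    (p : latticeΛ ι θ) : unitMap ι θ (w * z) p = unitMap ι θ w (unitMap ι θ z p) := by
  ext <;> simp [unitMap, mul_assoc]

theorem unitMap_one (ι : Fin 2 → K →+* ℝ) (θ : K) (p : latticeΛ ι θ) :
    unitMap ι θ 1 p = p := by
  ext <;> simp [unitMap]

/-- The action of `U_L^+` on `Λ` (written multiplicatively) by automorphisms. -/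
def unitAction (ι : Fin 2 → K →+* ℝ) (θ : K) :
    totallyPositiveUnits ι θ →* MulAut (Multiplicative (latticeΛ ι θ)) where
  toFun w :=
    { toFun := fun p => .ofAdd (unitMap ι θ w p.toAdd)
      invFun := fun p => .ofAdd (unitMap ι θ w⁻¹ p.toAdd)
      left_inv := fun p => by simp [← unitMap_mul, unitMap_one]
      right_inv := fun p => by simp [← unitMap_mul, unitMap_one]
      map_mul' := fun p q => by
        apply Multiplicative.toAdd.injective
        ext <;> simp [unitMap, mul_add] }
  map_one' := by
    ext1 p
    exact congrArg Multiplicative.ofAdd (unitMap_one ι θ p.toAdd)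
  map_mul' w z := by
    ext1 p
    exact congrArg Multiplicative.ofAdd (unitMap_mul ι θ w z p.toAdd)

/-- The group `S(Λ, V) = Λ ⋊ V`, for a subgroup `V` of `U_L^+`. -/
abbrev solvGroup (ι : Fin 2 → K →+* ℝ) (θ : K) (V : Subgroup (totallyPositiveUnits ι θ)) :
    Type _ :=
  Multiplicative (latticeΛ ι θ) ⋊[(unitAction ι θ).comp V.subtype] V

/-- The multiplier `σ_u(λ, η) = exp(πi u λ ∧ η)` on `Λ`, with `(a, b) ∧ (c, d) = ad - bc`. -/
def sigmaΛ (ι : Fin 2 → K →+* ℝ) (θ : K) (u : ℝ) (p q : Multiplicative (latticeΛ ι θ)) :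
    Circle :=
  Circle.exp (Real.pi * u * (p.toAdd.1.1 * q.toAdd.1.2 - p.toAdd.1.2 * q.toAdd.1.1))

end Lattice

end

/-! ## C*-algebras generated by a set -/

section Generated

variable {A B : Type*} [CStarAlgebra A] [CStarAlgebra B] {s : Set A}

/-! Every group in sight is built from copies of `ℤ` by semidirect products, hence amenable. For a
group with Følner sets, the algebra generated by the regular operators `R_γ` is already universal
for `σ`-projective unitary representations (`TwistedGroupCStar.exists_hom`). This rests on the
inequality `‖∑ c_s u_s‖ ≤ ‖∑ c_s R_s‖` for every such representation `u` (`norm_sum_smul_le`). It is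
proved by cutting the regular operator down to a Følner pair and using the resulting scalar matrix
with coefficients in the target algebra.

Universality makes the algebras functorial: an isomorphism of groups matching the multipliers
induces an isomorphism of algebras, and a group acting by multiplier-preserving automorphisms acts
on the algebra. It also identifies `C*(N, σ) ⋊ G` with `C*(N ⋊ G, σ̃)`
(`CrossedProduct.nonempty_equiv_twistedGroupCStar`) and `𝒜_t` with `C*(ℤ², σ_t)`
(`NCTorus.exists_equiv`). In both cases universality gives a map out of the twisted group algebra.
The map is injective because a suitable representation of its target turns it back into the regular
representation, and onto because its closed range contains the generators.

The arithmetic enters only in comparing `ℤ²` with `Λ`. In the basis `(1, θ)` the wedge product is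
`θ' - θ` times the standard determinant, so `σ_u` becomes `σ_t`. Multiplication by `ε` becomes an
integral matrix whose determinant is the norm of `ε`, a positive unit of `ℤ`. Since `ε` has infinite
order, `V` is a copy of `ℤ`, and all five algebras come from a single twisted semidirect product. -/

theorem generatedCStar_le {S : StarSubalgebra ℂ A} (hS : IsClosed (S : Set A)) (h : s ⊆ S) :
    generatedCStar s ≤ S :=
  StarSubalgebra.topologicalClosure_minimal (StarAlgebra.adjoin_le h) hS

theorem StarAlgHom.continuous_of_cstar (f : A →⋆ₐ[ℂ] B) : Continuous f :=
  AddMonoidHomClass.continuous_of_bound f 1 fun a => by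
    rw [one_mul]
    exact NonUnitalStarAlgHom.norm_apply_le f a

theorem StarAlgHom.isClosed_range_of_injective (f : A →⋆ₐ[ℂ] B) (hf : Function.Injective f) :
    IsClosed (f.range : Set B) := by
  have h : Isometry f := NonUnitalStarAlgHom.isometry f hf
  exact h.isClosedEmbedding.isClosed_range

theorem generatedCStar_hom_ext {f g : generatedCStar s →⋆ₐ[ℂ] B}
    (h : ∀ a (ha : a ∈ s), f ⟨a, mem_generatedCStar ha⟩ = g ⟨a, mem_generatedCStar ha⟩) :
    f = g := by
  refine StarAlgHom.ext_topologicalClosure f.continuous_of_cstar g.continuous_of_cstar ?_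
  ext x
  refine StarAlgebra.adjoin_induction_subtype (p := fun y => (f.comp
    (StarSubalgebra.inclusion (StarSubalgebra.le_topologicalClosure (StarAlgebra.adjoin ℂ s)))) y
    = (g.comp
    (StarSubalgebra.inclusion (StarSubalgebra.le_topologicalClosure (StarAlgebra.adjoin ℂ s)))) y)
    x ?_ ?_ ?_ ?_ ?_
  · exact fun a ha => h a ha
  · intro r
    rw [AlgHomClass.commutes, AlgHomClass.commutes]
  · intro x y hx hy
    rw [map_add, map_add, hx, hy]
  · intro x y hx hy
    rw [map_mul, map_mul, hx, hy]
  · intro x hx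
    rw [map_star, map_star, hx]

/-- An injective *-homomorphism of C*-algebras is isometric, so its range is closed; a closed
*-subalgebra containing the generators is everything. -/
theorem surjective_of_generators_mem_range (f : B →⋆ₐ[ℂ] generatedCStar s)
    (hf : Function.Injective f) (h : ∀ a (ha : a ∈ s), ∃ b, f b = ⟨a, mem_generatedCStar ha⟩) :
    Function.Surjective f := by
  have hg : Function.Injective ((generatedCStar s).subtype.comp f) :=
    Subtype.val_injective.comp hf
  have hle : generatedCStar s ≤ ((generatedCStar s).subtype.comp f).range := by
    refine generatedCStar_le (StarAlgHom.isClosed_range_of_injective _ hg) fun a ha => ?_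
    obtain ⟨b, hb⟩ := h a ha
    exact ⟨b, congrArg Subtype.val hb⟩
  rintro ⟨a, ha⟩
  obtain ⟨b, hb⟩ := hle ha
  exact ⟨b, Subtype.ext hb⟩

end Generated

/-! ## Følner sets -/

/-- Følner's condition: for finite `S` and `r > 1` there are finite sets `E ⊆ F` with
`E S ⊆ F`, `E ≠ ∅` and `|F| ≤ r |E|`. -/
def IsFolner (Γ : Type*) [Group Γ] : Prop :=
  ∀ (S : Finset Γ) (r : ℝ), 1 < r → ∃ E F : Finset Γ, E.Nonempty ∧
    (∀ x ∈ E, ∀ s ∈ S, x * s ∈ F) ∧ (F.card : ℝ) ≤ r * E.card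

theorem IsFolner.of_mulEquiv {Γ Δ : Type*} [Group Γ] [Group Δ] (h : IsFolner Γ) (e : Γ ≃* Δ) :
    IsFolner Δ := by
  classical
  intro S r hr
  obtain ⟨E, F, hE, hEF, hc⟩ := h (S.map e.symm.toEquiv.toEmbedding) r hr
  refine ⟨E.map e.toEquiv.toEmbedding, F.map e.toEquiv.toEmbedding, hE.map, ?_, ?_⟩
  · intro x hx s hs
    obtain ⟨y, hy, rfl⟩ := Finset.mem_map.1 hx
    refine Finset.mem_map.2 ⟨y * e.symm s, hEF y hy _ (Finset.mem_map.2 ⟨s, hs, rfl⟩), ?_⟩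
    simp
  · simpa using hc

theorem IsFolner.int : IsFolner (Multiplicative ℤ) := by
  intro S r hr
  obtain ⟨M, hM⟩ : ∃ M : ℕ, ∀ s ∈ S, |s.toAdd| ≤ M := by
    refine ⟨∑ s ∈ S, s.toAdd.natAbs, fun s hs => ?_⟩
    have := Finset.single_le_sum (f := fun s : Multiplicative ℤ => s.toAdd.natAbs)
      (fun _ _ => Nat.zero_le _) hs
    rw [Int.abs_eq_natAbs]
    exact_mod_cast this
  -- The interval `[0, n)` must be widened by `M` on both sides, and this choice of `n` is what
  -- gives `n + 2M ≤ r n`.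
  obtain ⟨n, hn⟩ := exists_nat_gt ((2 * M : ℝ) / (r - 1))
  rw [div_lt_iff₀ (by linarith)] at hn
  have hn0 : 0 < n := by
    rcases Nat.eq_zero_or_pos n with h | h
    · subst h
      have : (0 : ℝ) ≤ 2 * M := by positivity
      simp only [Nat.cast_zero, zero_mul] at hn
      linarith
    · exact h
  refine ⟨(Finset.Ico (0 : ℤ) n).map Multiplicative.ofAdd.toEmbedding,
    (Finset.Ico (-M : ℤ) (n + M)).map Multiplicative.ofAdd.toEmbedding, ?_, ?_, ?_⟩
  · simpa using hn0
  · intro x hx s hs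
    obtain ⟨y, hy, rfl⟩ := Finset.mem_map.1 hx
    have h := abs_le.1 (hM s hs)
    rw [Finset.mem_Ico] at hy
    refine Finset.mem_map.2 ⟨y + s.toAdd, Finset.mem_Ico.2 ⟨?_, ?_⟩, rfl⟩ <;> linarith
  · rw [Finset.card_map, Finset.card_map, Int.card_Ico, Int.card_Ico]
    have h1 : ((n : ℤ) + M - -M).toNat = n + 2 * M := by omega
    have h2 : ((n : ℤ) - 0).toNat = n := by omega
    rw [h1, h2]
    push_cast
    linarith

/-- Since `(y, h)(a, b) = (y · (h • a), h b)`, the sets for `G` are chosen first. The sets for `N`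
then have to absorb only the finitely many translates `h • a` with `h ∈ E₂`. A factor `√r` is spent
on each side. -/
theorem IsFolner.semidirectProduct {N G : Type*} [Group N] [Group G] (hN : IsFolner N)
    (hG : IsFolner G) (act : G →* MulAut N) : IsFolner (N ⋊[act] G) := by
  classical
  intro S r hr
  have hs : 1 < √r := Real.lt_sqrt_of_sq_lt (by simpa using hr)
  obtain ⟨E₂, F₂, hE₂, h₂, hc₂⟩ := hG (S.image SemidirectProduct.right) _ hs
  obtain ⟨E₁, F₁, hE₁, h₁, hc₁⟩ :=
    hN ((E₂ ×ˢ S).image fun p => act p.1 p.2.left) _ hs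
  let e : N × G ≃ N ⋊[act] G := SemidirectProduct.equivProd.symm
  refine ⟨(E₁ ×ˢ E₂).map e.toEmbedding, (F₁ ×ˢ F₂).map e.toEmbedding,
    (hE₁.product hE₂).map, ?_, ?_⟩
  · intro x hx s hs
    obtain ⟨⟨y, h⟩, hy, rfl⟩ := Finset.mem_map.1 hx
    rw [Finset.mem_product] at hy
    refine Finset.mem_map.2 ⟨(y * act h s.left, h * s.right), Finset.mem_product.2 ⟨?_, ?_⟩, ?_⟩
    · exact h₁ y hy.1 _ (Finset.mem_image.2 ⟨(h, s), Finset.mem_product.2 ⟨hy.2, hs⟩, rfl⟩)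
    · exact h₂ h hy.2 _ (Finset.mem_image_of_mem _ hs)
    · rfl
  · rw [Finset.card_map, Finset.card_map, Finset.card_product, Finset.card_product]
    push_cast
    calc (F₁.card : ℝ) * F₂.card ≤ (√r * E₁.card) * (√r * E₂.card) := by gcongr
      _ = (√r * √r) * (E₁.card * E₂.card) := by ring
      _ = r * (E₁.card * E₂.card) := by rw [Real.mul_self_sqrt (by linarith)]

/-! ## Multipliers and projective unitary representations -/

/-- A normalized `U(1)`-valued 2-cocycle on `Γ`. -/
structure IsMultiplier {Γ : Type*} [Group Γ] (σ : Γ → Γ → Circle) : Prop where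
  one_left : ∀ x, σ 1 x = 1
  one_right : ∀ x, σ x 1 = 1
  cocycle : ∀ x y z, σ x y * σ (x * y) z = σ x (y * z) * σ y z

/-- A `σ`-projective representation of `Γ` by unitaries of `B`. -/
structure IsProjRep {Γ B : Type*} [Group Γ] [CStarAlgebra B] (σ : Γ → Γ → Circle) (u : Γ → B) :
    Prop where
  mem_unitary : ∀ x, u x ∈ unitary B
  mul : ∀ x y, u x * u y = (σ x y : ℂ) • u (x * y)

section ProjRep

variable {Γ B C : Type*} [Group Γ] [CStarAlgebra B] [CStarAlgebra C] {σ : Γ → Γ → Circle}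

theorem Circle.star_coe_mul_coe (z : Circle) : star (z : ℂ) * (z : ℂ) = 1 := by
  have := Circle.coe_inv_eq_conj z
  rw [Complex.star_def, ← this]
  exact_mod_cast congrArg ((↑) : Circle → ℂ) (inv_mul_cancel z)

namespace IsProjRep

theorem map_one {u : Γ → B} (hu : IsProjRep σ u) (hσ : IsMultiplier σ) : u 1 = 1 := by
  have h := hu.mul 1 1
  rw [hσ.one_left, Circle.coe_one, one_smul, mul_one] at h
  have h1 := (Unitary.mem_iff.1 (hu.mem_unitary 1)).1
  calc u 1 = star (u 1) * u 1 * u 1 := by rw [h1, one_mul]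
    _ = 1 := by rw [mul_assoc, h, h1]

theorem star_eq {u : Γ → B} (hu : IsProjRep σ u) (hσ : IsMultiplier σ) (x : Γ) :
    star (u x) = star (σ x x⁻¹ : ℂ) • u x⁻¹ := by
  have h := hu.mul x x⁻¹
  rw [mul_inv_cancel, hu.map_one hσ] at h
  have h1 := (Unitary.mem_iff.1 (hu.mem_unitary x)).1
  have h2 : u x⁻¹ = (σ x x⁻¹ : ℂ) • star (u x) := by
    calc u x⁻¹ = star (u x) * u x * u x⁻¹ := by rw [h1, one_mul]
      _ = _ := by rw [mul_assoc, h, mul_smul_comm, mul_one]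
  rw [h2, smul_smul, Circle.star_coe_mul_coe, one_smul]

theorem map {u : Γ → B} (hu : IsProjRep σ u) (f : B →⋆ₐ[ℂ] C) : IsProjRep σ (fun x => f (u x)) where
  mem_unitary x := by
    obtain ⟨h1, h2⟩ := Unitary.mem_iff.1 (hu.mem_unitary x)
    rw [Unitary.mem_iff, ← map_star, ← map_mul, ← map_mul, h1, h2, _root_.map_one]
    exact ⟨rfl, rfl⟩
  mul x y := by rw [← map_mul, hu.mul, map_smul]

/-- The algebra generated by such a diagonal pair, with `u` regular, will be the graph of the
homomorphism sending `R_x` to `v x`. -/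
theorem prodMk {u : Γ → B} {v : Γ → C} (hu : IsProjRep σ u) (hv : IsProjRep σ v) :
    IsProjRep σ (fun x => (u x, v x)) where
  mem_unitary x := by
    obtain ⟨h1, h2⟩ := Unitary.mem_iff.1 (hu.mem_unitary x)
    obtain ⟨h3, h4⟩ := Unitary.mem_iff.1 (hv.mem_unitary x)
    exact Unitary.mem_iff.2 ⟨Prod.ext h1 h3, Prod.ext h2 h4⟩
  mul x y := Prod.ext (hu.mul x y) (hv.mul x y)

theorem comp_mulEquiv {Δ : Type*} [Group Δ] {u : Γ → B} (hu : IsProjRep σ u) (e : Δ ≃* Γ) :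
    IsProjRep (fun x y => σ (e x) (e y)) (fun x => u (e x)) where
  mem_unitary x := hu.mem_unitary _
  mul x y := by rw [hu.mul, map_mul]

/-- Products and adjoints of the `u x` are again scalar multiples of some `u y`, so the linear span
is already a *-algebra. Norm estimates thus reduce to finite linear combinations. -/
theorem adjoin_le_span {u : Γ → B} (hu : IsProjRep σ u) (hσ : IsMultiplier σ) {b : B}
    (hb : b ∈ StarAlgebra.adjoin ℂ (Set.range u)) :
    b ∈ Submodule.span ℂ (Set.range u) := by
  induction hb using StarAlgebra.adjoin_induction with
  | mem x hx => exact Submodule.subset_span hx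
  | algebraMap r =>
    rw [Algebra.algebraMap_eq_smul_one, ← hu.map_one hσ]
    exact Submodule.smul_mem _ _ (Submodule.subset_span ⟨1, rfl⟩)
  | add x y _ _ hx hy => exact Submodule.add_mem _ hx hy
  | mul x y hx' hy' hx hy =>
    clear hx' hy'
    induction hx using Submodule.span_induction with
    | zero => rw [zero_mul]; exact Submodule.zero_mem _
    | add a b _ _ ha hb => rw [add_mul]; exact Submodule.add_mem _ ha hb
    | smul c a _ ha => rw [smul_mul_assoc]; exact Submodule.smul_mem _ _ ha
    | mem a ha =>
      obtain ⟨g, rfl⟩ := ha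
      induction hy using Submodule.span_induction with
      | zero => rw [mul_zero]; exact Submodule.zero_mem _
      | add a b _ _ ha hb => rw [mul_add]; exact Submodule.add_mem _ ha hb
      | smul c a _ ha => rw [mul_smul_comm]; exact Submodule.smul_mem _ _ ha
      | mem a ha =>
        obtain ⟨h, rfl⟩ := ha
        rw [hu.mul]
        exact Submodule.smul_mem _ _ (Submodule.subset_span ⟨_, rfl⟩)
  | star x hx' hx =>
    clear hx'
    induction hx using Submodule.span_induction with
    | zero => rw [star_zero]; exact Submodule.zero_mem _
    | add a b _ _ ha hb => rw [star_add]; exact Submodule.add_mem _ ha hb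
    | smul c a _ ha => rw [star_smul]; exact Submodule.smul_mem _ _ ha
    | mem a ha =>
      obtain ⟨g, rfl⟩ := ha
      rw [hu.star_eq hσ]
      exact Submodule.smul_mem _ _ (Submodule.subset_span ⟨_, rfl⟩)

end IsProjRep

end ProjRep

/-! ## The regular projective representation -/

section Regular

variable {Γ : Type*} [Group Γ] {σ : Γ → Γ → Circle}

theorem twistedTranslation_mul (hσ : IsMultiplier σ) (x y : Γ) :
    twistedTranslation σ x * twistedTranslation σ y =
      (σ x y : ℂ) • twistedTranslation σ (x * y) := by
  ext f z
  change f (z * x * y) * (σ (z * x) y : ℂ) * (σ z x : ℂ) =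
    (σ x y : ℂ) * (f (z * (x * y)) * (σ z (x * y) : ℂ))
  have h := congrArg ((↑) : Circle → ℂ) (hσ.cocycle z x y)
  simp only [Circle.coe_mul] at h
  rw [mul_assoc z x y]
  linear_combination f (z * (x * y)) * h

theorem twistedTranslation_one (hσ : IsMultiplier σ) :
    twistedTranslation σ (1 : Γ) = 1 := by
  ext f z
  change f (z * 1) * (σ z 1 : ℂ) = f z
  rw [hσ.one_right, mul_one, Circle.coe_one, mul_one]

theorem norm_twistedTranslation_apply_le (γ : Γ) (f : ell2 Γ) :
    ‖twistedTranslation σ γ f‖ ≤ ‖f‖ := by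
  have := (twistedTranslation σ γ).le_of_opNorm_le
    (LinearMap.mkContinuous_norm_le _ zero_le_one _) f
  rwa [one_mul] at this

theorem twistedTranslation_mem_unitary (hσ : IsMultiplier σ) (γ : Γ) :
    twistedTranslation σ γ ∈ unitary (ell2 Γ →L[ℂ] ell2 Γ) := by
  have h1 := twistedTranslation_mul hσ γ⁻¹ γ
  have h2 := twistedTranslation_mul hσ γ γ⁻¹
  rw [inv_mul_cancel, twistedTranslation_one hσ] at h1
  rw [mul_inv_cancel, twistedTranslation_one hσ] at h2
  -- The operators at `γ` and `γ⁻¹` are contractions whose product is a unimodular scalar, so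
  -- neither can shrink a vector.
  have hiso : ∀ f, ‖twistedTranslation σ γ f‖ = ‖f‖ := fun f => by
    refine le_antisymm (norm_twistedTranslation_apply_le γ f) ?_
    have h3 : ‖(twistedTranslation σ γ⁻¹ * twistedTranslation σ γ) f‖ = ‖f‖ := by
      rw [h1, smul_apply, norm_smul, Circle.norm_coe, one_mul]
      rfl
    rw [← h3]
    exact norm_twistedTranslation_apply_le _ _
  have hs : star (twistedTranslation σ γ) * twistedTranslation σ γ = 1 :=
    (ContinuousLinearMap.norm_map_iff_adjoint_comp_self _).1 hiso
  have hr : twistedTranslation σ γ *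
      (star (σ γ γ⁻¹ : ℂ) • twistedTranslation σ γ⁻¹) = 1 := by
    rw [mul_smul_comm, h2, smul_smul, Circle.star_coe_mul_coe, one_smul]
  refine Unitary.mem_iff.2 ⟨hs, ?_⟩
  rw [left_inv_eq_right_inv hs hr, hr]

theorem isProjRep_twistedTranslation (hσ : IsMultiplier σ) :
    IsProjRep σ (twistedTranslation σ) where
  mem_unitary := twistedTranslation_mem_unitary hσ
  mul := twistedTranslation_mul hσ

theorem isProjRep_R (hσ : IsMultiplier σ) : IsProjRep σ (TwistedGroupCStar.R σ) where
  mem_unitary x := Unitary.mem_iff.2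
    ⟨Subtype.ext (Unitary.mem_iff.1 (twistedTranslation_mem_unitary hσ x)).1,
      Subtype.ext (Unitary.mem_iff.1 (twistedTranslation_mem_unitary hσ x)).2⟩
  mul x y := Subtype.ext (twistedTranslation_mul hσ x y)

end Regular

/-! ## The norm inequality for groups satisfying Følner's condition -/

section NormBound

theorem sum_star_mul_eq_conjTranspose_mul {B : Type*} [CStarAlgebra B] {k n : Type*} [Fintype k]
    [Fintype n] (Q : Matrix k n ℂ) (ξ : n → B) :
    ∑ i, star (∑ j, Q i j • ξ j) * (∑ j, Q i j • ξ j) =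
      ∑ a, ∑ b, (Q.conjTranspose * Q) a b • (star (ξ a) * ξ b) := by
  simp only [star_sum, star_smul, Finset.sum_mul_sum, smul_mul_smul_comm, Matrix.mul_apply,
    Matrix.conjTranspose_apply, Finset.sum_smul]
  rw [Finset.sum_comm]
  refine Finset.sum_congr rfl fun a _ => ?_
  rw [Finset.sum_comm]

theorem dotProduct_star_self_eq_sum_norm_sq {k : Type*} [Fintype k] (w : k → ℂ) :
    dotProduct (star w) w = ((∑ j, ‖w j‖ ^ 2 : ℝ) : ℂ) := by
  simp only [dotProduct, Pi.star_apply, Complex.star_def, Complex.conj_mul']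
  push_cast
  rfl

open scoped ComplexOrder in
-- A scalar matrix inequality `A*A ≤ M` survives with coefficients in a C*-algebra. Write `M - A*A =
-- Q*Q`; the difference of the two sides is then `∑ (Qξ)_i* (Qξ)_i ≥ 0`.
theorem sum_star_mul_le_of_matrix_bound {B : Type*} [CStarAlgebra B] [PartialOrder B]
    [StarOrderedRing B] {m n : Type*} [Fintype m] [Fintype n] (A : Matrix m n ℂ) (M : ℝ)
    (hA : ∀ z : n → ℂ, ∑ i, ‖A.mulVec z i‖ ^ 2 ≤ M * ∑ j, ‖z j‖ ^ 2) (ξ : n → B) :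
    ∑ i, star (∑ j, A i j • ξ j) * (∑ j, A i j • ξ j) ≤
      (M : ℂ) • ∑ j, star (ξ j) * ξ j := by
  classical
  let P : Matrix n n ℂ := (M : ℂ) • 1 - A.conjTranspose * A
  have hP : P.PosSemidef := by
    refine Matrix.PosSemidef.of_dotProduct_mulVec_nonneg ?_ fun z => ?_
    · refine Matrix.IsHermitian.sub ?_ (Matrix.isHermitian_conjTranspose_mul_self A)
      rw [Matrix.IsHermitian, Matrix.conjTranspose_smul, Matrix.conjTranspose_one]
      simp
    · have h1 : dotProduct (star z) (P.mulVec z) =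
          ((M * ∑ j, ‖z j‖ ^ 2 - ∑ i, ‖A.mulVec z i‖ ^ 2 : ℝ) : ℂ) := by
        rw [Matrix.sub_mulVec, Matrix.smul_mulVec, Matrix.one_mulVec, dotProduct_sub,
          dotProduct_smul, dotProduct_star_self_eq_sum_norm_sq, ← Matrix.mulVec_mulVec, Matrix.dotProduct_mulVec,
          Matrix.vecMul_conjTranspose, star_star, dotProduct_star_self_eq_sum_norm_sq]
        push_cast
        rfl
      rw [h1]
      exact_mod_cast sub_nonneg.2 (hA z)
  obtain ⟨Q, hQ⟩ : ∃ Q : Matrix n n ℂ, P = Q.conjTranspose * Q := by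
    open scoped MatrixOrder in
    exact CStarAlgebra.nonneg_iff_eq_star_mul_self.1 hP.nonneg
  have hnn : (0 : B) ≤ ∑ i, star (∑ j, Q i j • ξ j) * (∑ j, Q i j • ξ j) :=
    Finset.sum_nonneg fun i _ => star_mul_self_nonneg _
  rw [sum_star_mul_eq_conjTranspose_mul, ← hQ] at hnn
  rw [sum_star_mul_eq_conjTranspose_mul, ← sub_nonneg]
  convert hnn using 1
  simp only [P, Matrix.sub_apply, Matrix.smul_apply, sub_smul, Finset.sum_sub_distrib,
    Matrix.one_apply, smul_eq_mul, mul_ite, mul_one, mul_zero, ite_smul, zero_smul,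
    Finset.sum_ite_eq, Finset.mem_univ, if_true, Finset.smul_sum]

variable {Γ B : Type*} [Group Γ] [CStarAlgebra B] {σ : Γ → Γ → Circle}

/-- The matrix is the compression of the operator to rows in `E` and columns in `F`: extend `z` by
zero to a vector of `ℓ²(Γ)`, apply the operator, and restrict to `E`. -/
theorem sum_norm_sq_compression_le (S : Finset Γ) (c : Γ → ℂ) (E F : Finset Γ) [DecidableEq Γ]
    (hEF : ∀ x ∈ E, ∀ s ∈ S, x * s ∈ F) (z : F → ℂ) :
    ∑ x : E, ‖Matrix.mulVec (Matrix.of fun (x : E) (y : F) =>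
        ∑ s ∈ S, if (x : Γ) * s = y then c s * (σ x s : ℂ) else 0) z x‖ ^ 2 ≤
      ‖∑ s ∈ S, c s • twistedTranslation σ s‖ ^ 2 * ∑ y, ‖z y‖ ^ 2 := by
  let f : ell2 Γ := ∑ y ∈ F, lp.single 2 y (if h : y ∈ F then z ⟨y, h⟩ else 0)
  have hf : ∀ y, f y = if h : y ∈ F then z ⟨y, h⟩ else 0 := by
    intro y
    simp only [f, lp.coeFn_sum, Finset.sum_apply, lp.single_apply, Pi.single_apply]
    rw [Finset.sum_ite_eq]
    split_ifs <;> rfl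
  have hnorm : ‖f‖ ^ 2 = ∑ y, ‖z y‖ ^ 2 := by
    have := lp.norm_sum_single (p := 2) (by norm_num)
      (fun y => if h : y ∈ F then z ⟨y, h⟩ else 0) F
    simp only [ENNReal.toReal_ofNat, Real.rpow_two] at this
    rw [this, ← Finset.sum_coe_sort]
    simp
  have hval : ∀ x : E, Matrix.mulVec (Matrix.of fun (x : E) (y : F) =>
        ∑ s ∈ S, if (x : Γ) * s = y then c s * (σ x s : ℂ) else 0) z x =
      (∑ s ∈ S, c s • twistedTranslation σ s) f x := by
    intro x
    have h1 : (∑ s ∈ S, c s • twistedTranslation σ s) f x =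
        ∑ s ∈ S, c s * (f (x * s) * (σ x s : ℂ)) := by
      rw [sum_apply, lp.coeFn_sum, Finset.sum_apply]
      rfl
    rw [h1]
    simp only [Matrix.mulVec, dotProduct, Matrix.of_apply, Finset.sum_mul]
    rw [Finset.sum_comm]
    refine Finset.sum_congr rfl fun s hs => ?_
    rw [hf, dif_pos (hEF x x.2 s hs), Finset.sum_eq_single ⟨x * s, hEF x x.2 s hs⟩]
    · simp only [if_true]
      ring
    · intro y _ hy
      rw [if_neg, zero_mul]
      exact fun h => hy (Subtype.ext h.symm)
    · exact fun h => absurd (Finset.mem_univ _) h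
  calc _ = ∑ x : E, ‖(∑ s ∈ S, c s • twistedTranslation σ s) f x‖ ^ 2 := by simp only [hval]
    _ = ∑ x ∈ E, ‖(∑ s ∈ S, c s • twistedTranslation σ s) f x‖ ^ 2 :=
      Finset.sum_coe_sort E (fun x => ‖(∑ s ∈ S, c s • twistedTranslation σ s) f x‖ ^ 2)
    _ ≤ ‖(∑ s ∈ S, c s • twistedTranslation σ s) f‖ ^ 2 := by
      have := lp.sum_rpow_le_norm_rpow (p := 2) (by norm_num)
        ((∑ s ∈ S, c s • twistedTranslation σ s) f) E
      simpa only [ENNReal.toReal_ofNat, Real.rpow_two] using this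
    _ ≤ (‖∑ s ∈ S, c s • twistedTranslation σ s‖ * ‖f‖) ^ 2 := by
      gcongr
      exact ContinuousLinearMap.le_opNorm _ _
    _ = _ := by rw [mul_pow, hnorm]

/-- Let `a` be the regular sum and `b` the sum in `B`. Applied to the column `(u y)`, `y ∈ F`, the
compressed matrix of `a` gives the column `(u x · b)`, `x ∈ E`. As the `u x` are unitary, this
yields `|E| b*b ≤ ‖a‖² |F|`, hence `‖b‖² ≤ r ‖a‖²` for every `r > 1`. -/
theorem norm_sum_smul_le (hΓ : IsFolner Γ) {u : Γ → B} (hu : IsProjRep σ u)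
    (S : Finset Γ) (c : Γ → ℂ) :
    ‖∑ s ∈ S, c s • u s‖ ≤ ‖∑ s ∈ S, c s • twistedTranslation σ s‖ := by
  classical
  rcases subsingleton_or_nontrivial B with _ | _
  · rw [Subsingleton.elim (∑ s ∈ S, c s • u s) 0, norm_zero]
    exact norm_nonneg _
  set a := ∑ s ∈ S, c s • twistedTranslation σ s with ha
  set b := ∑ s ∈ S, c s • u s with hb
  let _ : PartialOrder B := CStarAlgebra.spectralOrder B
  have _ : StarOrderedRing B := CStarAlgebra.spectralOrderedRing B
  have key : ∀ r : ℝ, 1 < r → ‖b‖ ^ 2 ≤ ‖a‖ ^ 2 * r := by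
    intro r hr
    obtain ⟨E, F, hE, hEF, hc⟩ := hΓ S r hr
    have h := sum_star_mul_le_of_matrix_bound _ _ (sum_norm_sq_compression_le (σ := σ) S c E F hEF)
      (fun y : F => u y)
    -- This is where `E S ⊆ F` is essential: every `x s` occurs as a column, so no term of `u x · b`
    -- is lost.
    have hrow : ∀ x : E, ∑ y : F, (Matrix.of fun (x : E) (y : F) =>
        ∑ s ∈ S, if (x : Γ) * s = y then c s * (σ x s : ℂ) else 0) x y • u y = u x * b := by
      intro x
      simp only [Matrix.of_apply, Finset.sum_smul, hb, Finset.mul_sum]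
      rw [Finset.sum_comm]
      refine Finset.sum_congr rfl fun s hs => ?_
      rw [Finset.sum_eq_single ⟨x * s, hEF x x.2 s hs⟩]
      · rw [if_pos rfl, mul_smul_comm, hu.mul, smul_smul]
      · intro y _ hy
        rw [if_neg, zero_smul]
        exact fun h => hy (Subtype.ext h.symm)
      · exact fun h => absurd (Finset.mem_univ _) h
    have hl : ∀ x : E, star (u x * b) * (u x * b) = star b * b := by
      intro x
      rw [star_mul, mul_assoc, ← mul_assoc (star (u x)), (Unitary.mem_iff.1 (hu.mem_unitary x)).1,
        one_mul]
    have hr' : ∀ y : F, star (u y) * u y = 1 := fun y =>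
      (Unitary.mem_iff.1 (hu.mem_unitary y)).1
    simp only [hrow, hl, hr', Finset.sum_const, Finset.card_univ, Fintype.card_coe] at h
    rw [← ha] at h
    have h0 : (0 : B) ≤ E.card • (star b * b) := nsmul_nonneg (star_mul_self_nonneg b) _
    have h2 := CStarAlgebra.norm_le_norm_of_nonneg_of_le h0 h
    rw [← Nat.cast_smul_eq_nsmul ℂ, ← Nat.cast_smul_eq_nsmul ℂ, norm_smul, norm_smul, norm_smul,
      CStarRing.norm_star_mul_self, norm_one, Complex.norm_real, Complex.norm_natCast,
      Complex.norm_natCast, Real.norm_of_nonneg (sq_nonneg _)] at h2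
    have hEc : (0 : ℝ) < E.card := by exact_mod_cast hE.card_pos
    have h3 : (E.card : ℝ) * ‖b‖ ^ 2 ≤ E.card * (‖a‖ ^ 2 * r) := by
      calc (E.card : ℝ) * ‖b‖ ^ 2 = E.card * (‖b‖ * ‖b‖) := by rw [sq]
        _ ≤ ‖a‖ ^ 2 * (F.card * 1) := h2
        _ ≤ ‖a‖ ^ 2 * (r * E.card * 1) := by gcongr
        _ = _ := by ring
    exact le_of_mul_le_mul_left h3 hEc
  have h4 : ‖b‖ ^ 2 ≤ ‖a‖ ^ 2 := by
    have hlim : Filter.Tendsto (fun r : ℝ => ‖a‖ ^ 2 * r) (nhdsWithin 1 (Set.Ioi 1))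
        (nhds (‖a‖ ^ 2 * 1)) :=
      (tendsto_const_nhds.mul Filter.tendsto_id).mono_left nhdsWithin_le_nhds
    rw [mul_one] at hlim
    exact ge_of_tendsto hlim (Filter.eventually_of_mem self_mem_nhdsWithin key)
  exact le_of_sq_le_sq h4 (norm_nonneg _)

end NormBound

/-! ## The universal property of twisted group C*-algebras -/

section Universal

variable {Γ Δ B : Type*} [Group Γ] [Group Δ] [CStarAlgebra B] {σ : Γ → Γ → Circle}
  {τ : Δ → Δ → Circle}

/-- The inequality is a closed condition, and on the dense span of the generators it is
`norm_sum_smul_le`. -/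
theorem norm_snd_le_norm_fst_of_mem_generatedCStar (hΓ : IsFolner Γ) (hσ : IsMultiplier σ)
    {u : Γ → B} (hu : IsProjRep σ u) {d : (ell2 Γ →L[ℂ] ell2 Γ) × B}
    (hd : d ∈ generatedCStar (Set.range fun x => (twistedTranslation σ x, u x))) :
    ‖d.2‖ ≤ ‖d.1‖ := by
  classical
  have hw := (isProjRep_twistedTranslation hσ).prodMk hu
  have hclosed : IsClosed {d : (ell2 Γ →L[ℂ] ell2 Γ) × B | ‖d.2‖ ≤ ‖d.1‖} :=
    isClosed_le (continuous_norm.comp continuous_snd) (continuous_norm.comp continuous_fst)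
  refine closure_minimal ?_ hclosed hd
  intro x hx
  obtain ⟨c, rfl⟩ := Finsupp.mem_span_range_iff_exists_finsupp.1 (hw.adjoin_le_span hσ hx)
  simpa [Finsupp.sum, Prod.fst_sum, Prod.snd_sum] using norm_sum_smul_le hΓ hu c.support c

/-- The algebra `D` generated by the pairs `(R_x, u x)` is the graph of the desired map. Its first
projection is injective by the norm inequality and reaches all generators, so it can be inverted and
followed by the second projection. -/
theorem TwistedGroupCStar.exists_hom (hΓ : IsFolner Γ) (hσ : IsMultiplier σ)
    {u : Γ → B} (hu : IsProjRep σ u) :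
    ∃ f : TwistedGroupCStar σ →⋆ₐ[ℂ] B, ∀ x, f (TwistedGroupCStar.R σ x) = u x := by
  let w : Γ → (ell2 Γ →L[ℂ] ell2 Γ) × B := fun x => (twistedTranslation σ x, u x)
  let D := generatedCStar (Set.range w)
  let fstD : D →⋆ₐ[ℂ] (ell2 Γ →L[ℂ] ell2 Γ) := (StarAlgHom.fst ℂ _ _).comp D.subtype
  have hmem : ∀ d : D, fstD d ∈ generatedCStar (Set.range (twistedTranslation σ)) := by
    have hle : D ≤ (generatedCStar (Set.range (twistedTranslation σ))).comap
        (StarAlgHom.fst ℂ (ell2 Γ →L[ℂ] ell2 Γ) B) := by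
      refine generatedCStar_le ?_ ?_
      · exact (generatedCStar_isClosed (Set.range (twistedTranslation σ))).preimage continuous_fst
      · rintro _ ⟨x, rfl⟩
        exact mem_generatedCStar ⟨x, rfl⟩
    exact fun d => hle d.2
  let q : D →⋆ₐ[ℂ] generatedCStar (Set.range (twistedTranslation σ)) :=
    StarAlgHom.codRestrict fstD _ hmem
  have hinj : Function.Injective q := by
    refine (injective_iff_map_eq_zero q).2 fun d hd => ?_
    have h1 : d.1.1 = 0 := congrArg Subtype.val hd
    have h2 := norm_snd_le_norm_fst_of_mem_generatedCStar hΓ hσ hu d.2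
    rw [h1, norm_zero, norm_le_zero_iff] at h2
    exact Subtype.ext (Prod.ext h1 h2)
  have hsurj : Function.Surjective q := by
    refine surjective_of_generators_mem_range q hinj ?_
    rintro _ ⟨x, rfl⟩
    exact ⟨⟨w x, mem_generatedCStar ⟨x, rfl⟩⟩, rfl⟩
  let e : D ≃⋆ₐ[ℂ] TwistedGroupCStar σ := StarAlgEquiv.ofBijective q ⟨hinj, hsurj⟩
  let e' : TwistedGroupCStar σ →⋆ₐ[ℂ] D := e.symm
  refine ⟨((StarAlgHom.snd ℂ _ _).comp D.subtype).comp e', fun x => ?_⟩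
  have hx : e ⟨w x, mem_generatedCStar ⟨x, rfl⟩⟩ = TwistedGroupCStar.R σ x := rfl
  change ((e.symm (TwistedGroupCStar.R σ x)).1).2 = u x
  rw [← hx, StarAlgEquiv.symm_apply_apply]

theorem TwistedGroupCStar.hom_ext {f g : TwistedGroupCStar σ →⋆ₐ[ℂ] B}
    (h : ∀ x, f (TwistedGroupCStar.R σ x) = g (TwistedGroupCStar.R σ x)) : f = g := by
  refine generatedCStar_hom_ext (s := Set.range (twistedTranslation σ)) ?_
  rintro _ ⟨x, rfl⟩
  exact h x

/-- The regular representation of `C*(Γ, σ)` on `ℓ²(Γ)`. -/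
noncomputable def TwistedGroupCStar.regular (σ : Γ → Γ → Circle) :
    TwistedGroupCStar σ →⋆ₐ[ℂ] (ell2 Γ →L[ℂ] ell2 Γ) :=
  (generatedCStar (Set.range (twistedTranslation σ))).subtype

theorem TwistedGroupCStar.regular_R (x : Γ) :
    TwistedGroupCStar.regular σ (TwistedGroupCStar.R σ x) = twistedTranslation σ x := rfl

theorem TwistedGroupCStar.regular_injective :
    Function.Injective (TwistedGroupCStar.regular σ) :=
  Subtype.val_injective

theorem TwistedGroupCStar.isProjRep_comp (hτ : IsMultiplier τ) (e : Γ ≃* Δ)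
    (h : ∀ x y, τ (e x) (e y) = σ x y) :
    IsProjRep σ (fun x => TwistedGroupCStar.R τ (e x)) := by
  have := (isProjRep_R hτ).comp_mulEquiv e
  simpa only [h] using this

theorem IsMultiplier.comp_mulEquiv (hτ : IsMultiplier τ) (e : Γ ≃* Δ)
    (h : ∀ x y, τ (e x) (e y) = σ x y) : IsMultiplier σ where
  one_left x := by rw [← h, map_one, hτ.one_left]
  one_right x := by rw [← h, map_one, hτ.one_right]
  cocycle x y z := by simp only [← h, map_mul, hτ.cocycle]

theorem TwistedGroupCStar.exists_equiv (hΓ : IsFolner Γ) (hτ : IsMultiplier τ) (e : Γ ≃* Δ)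
    (h : ∀ x y, τ (e x) (e y) = σ x y) :
    ∃ f : TwistedGroupCStar σ ≃⋆ₐ[ℂ] TwistedGroupCStar τ,
      ∀ x, f (TwistedGroupCStar.R σ x) = TwistedGroupCStar.R τ (e x) := by
  have hσ := hτ.comp_mulEquiv e h
  have h' : ∀ x y, σ (e.symm x) (e.symm y) = τ x y := fun x y => by
    rw [← h, e.apply_symm_apply, e.apply_symm_apply]
  obtain ⟨f, hf⟩ := exists_hom hΓ hσ (isProjRep_comp hτ e h)
  obtain ⟨g, hg⟩ := exists_hom (hΓ.of_mulEquiv e) hτ (isProjRep_comp hσ e.symm h')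
  have hgf : g.comp f = StarAlgHom.id ℂ _ := hom_ext fun x => by
    rw [StarAlgHom.comp_apply, hf, hg, e.symm_apply_apply]
    rfl
  have hfg : f.comp g = StarAlgHom.id ℂ _ := hom_ext fun x => by
    rw [StarAlgHom.comp_apply, hg, hf, e.apply_symm_apply]
    rfl
  exact ⟨StarAlgEquiv.ofBijective f
    ⟨Function.LeftInverse.injective (g := g) (DFunLike.congr_fun hgf),
      Function.RightInverse.surjective (g := g) (DFunLike.congr_fun hfg)⟩, hf⟩

theorem TwistedGroupCStar.equiv_ext {f g : TwistedGroupCStar σ ≃⋆ₐ[ℂ] B}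
    (h : ∀ x, f (TwistedGroupCStar.R σ x) = g (TwistedGroupCStar.R σ x)) : f = g := by
  have : (f : TwistedGroupCStar σ →⋆ₐ[ℂ] B) = g := hom_ext h
  ext a
  exact DFunLike.congr_fun this a

theorem TwistedGroupCStar.exists_action {G : Type*} [Group G] (hΓ : IsFolner Γ)
    (hσ : IsMultiplier σ) (act : G →* MulAut Γ)
    (h : ∀ g x y, σ (act g x) (act g y) = σ x y) :
    ∃ υ : G →* (TwistedGroupCStar σ ≃⋆ₐ[ℂ] TwistedGroupCStar σ),
      ∀ g x, υ g (TwistedGroupCStar.R σ x) = TwistedGroupCStar.R σ (act g x) := by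
  choose f hf using fun g => exists_equiv hΓ hσ (act g) (h g)
  refine ⟨MonoidHom.mk' f fun g g' => equiv_ext fun x => ?_, hf⟩
  change f (g * g') _ = f g (f g' _)
  rw [hf, hf, hf, map_mul]
  rfl

end Universal

/-! ## Twisted semidirect products -/

theorem IsMultiplier.semidirectTwist {N G : Type*} [Group N] [Group G] {σ : N → N → Circle}
    (hσ : IsMultiplier σ) (act : G →* MulAut N)
    (h : ∀ g x y, σ (act g x) (act g y) = σ x y) : IsMultiplier (semidirectTwist act σ) where
  one_left x := hσ.one_left _
  one_right x := by
    change σ x.left (act x.right 1) = 1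
    rw [map_one, hσ.one_right]
  cocycle x y z := by
    change σ x.left (act x.right y.left) *
        σ (x.left * act x.right y.left) (act (x.right * y.right) z.left) =
      σ x.left (act x.right (y.left * act y.right z.left)) * σ y.left (act y.right z.left)
    rw [hσ.cocycle, map_mul, map_mul, MulAut.mul_apply, h]

/-! ## Evaluation maps of bounded products -/

/-- The `j`-th coordinate of a bounded product of C*-algebras, as a *-homomorphism. -/
noncomputable def boundedProductEval {J : Type*} {B : J → Type*} [∀ j, CStarAlgebra (B j)]
    [∀ j, Nontrivial (B j)] (j : J) : lp B ∞ →⋆ₐ[ℂ] B j where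
  toFun f := f j
  map_one' := rfl
  map_mul' _ _ := rfl
  map_zero' := rfl
  map_add' _ _ := rfl
  commutes' _ := rfl
  map_star' _ := rfl

instance ell2_nontrivial (Γ : Type*) [Nonempty Γ] : Nontrivial (ell2 Γ) := by
  classical
  obtain ⟨x⟩ := ‹Nonempty Γ›
  refine ⟨lp.single 2 x 1, 0, fun h => ?_⟩
  have := congrArg (fun f : ell2 Γ => f x) h
  simp at this

/-! ## Projective representations of semidirect products -/

namespace IsProjRep

variable {N G B : Type*} [Group N] [Group G] [CStarAlgebra B] {σ : N → N → Circle}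
  {act : G →* MulAut N} {u : N ⋊[act] G → B}

open SemidirectProduct

theorem comp_inl (hu : IsProjRep (semidirectTwist act σ) u) : IsProjRep σ (fun x => u (inl x)) where
  mem_unitary x := hu.mem_unitary _
  mul x y := by
    rw [hu.mul, map_mul]
    simp [semidirectTwist]

theorem inr_mul_inr (hu : IsProjRep (semidirectTwist act σ) u) (hσ : IsMultiplier σ) (g h : G) :
    u (inr g) * u (inr h) = u (inr (g * h)) := by
  rw [hu.mul, map_mul]
  simp [semidirectTwist, hσ.one_left]

theorem inl_mul_inr (hu : IsProjRep (semidirectTwist act σ) u) (hσ : IsMultiplier σ) (x : N)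
    (g : G) : u (inl x) * u (inr g) = u (inl x * inr g) := by
  rw [hu.mul]
  simp [semidirectTwist, hσ.one_right]

/-- This is the covariance relation. It has no phase because `σ̃` takes the value `1` on both pairs
involved, one of the two arguments of `σ` being the identity. -/
theorem inr_mul_inl (hu : IsProjRep (semidirectTwist act σ) u) (hσ : IsMultiplier σ) (x : N)
    (g : G) : u (inr g) * u (inl x) = u (inl (act g x)) * u (inr g) := by
  have h : (inl (act g x) * inr g : N ⋊[act] G) = inr g * inl x := by
    rw [inl_aut, mul_assoc, ← map_mul, inv_mul_cancel, _root_.map_one, mul_one]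
  rw [hu.mul, hu.inl_mul_inr hσ, h]
  simp [semidirectTwist, hσ.one_left]

/-- The unitary representation of `G` obtained by restricting a `σ̃`-projective representation of
`N ⋊ G`. -/
noncomputable def restrictRight (hu : IsProjRep (semidirectTwist act σ) u) (hσ : IsMultiplier σ) :
    G →* unitary B :=
  MonoidHom.mk' (fun g => ⟨u (inr g), hu.mem_unitary _⟩)
    fun g h => Subtype.ext (hu.inr_mul_inr hσ g h).symm

end IsProjRep

/-! ## Crossed products of twisted group C*-algebras -/

universe u v

namespace CrossedProduct

variable {A : Type u} [CStarAlgebra A] {G : Type v} [Group G] {α : G →* (A ≃⋆ₐ[ℂ] A)}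

/-- The canonical map of `A` into `A ⋊ G`. -/
noncomputable def ofAlgebra (α : G →* (A ≃⋆ₐ[ℂ] A)) : A →⋆ₐ[ℂ] CrossedProduct α where
  toFun a := ⟨CovariantRep.univπ α a, mem_generatedCStar (Or.inl ⟨a, rfl⟩)⟩
  map_one' := by
    refine Subtype.ext (Subtype.ext (funext fun ρ => ?_))
    exact map_one ρ.π
  map_mul' a b := by
    refine Subtype.ext (Subtype.ext (funext fun ρ => ?_))
    exact map_mul ρ.π a b
  map_zero' := by
    refine Subtype.ext (Subtype.ext (funext fun ρ => ?_))
    exact map_zero ρ.π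
  map_add' a b := by
    refine Subtype.ext (Subtype.ext (funext fun ρ => ?_))
    exact map_add ρ.π a b
  commutes' r := by
    refine Subtype.ext (Subtype.ext (funext fun ρ => ?_))
    exact AlgHomClass.commutes ρ.π r
  map_star' a := by
    refine Subtype.ext (Subtype.ext (funext fun ρ => ?_))
    exact map_star ρ.π a

/-- The canonical element of `A ⋊ G` given by `g ∈ G`. -/
noncomputable def ofGroup (α : G →* (A ≃⋆ₐ[ℂ] A)) (g : G) : CrossedProduct α :=
  ⟨CovariantRep.univW α g, mem_generatedCStar (Or.inr ⟨g, rfl⟩)⟩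

theorem ofGroup_mem_unitary (g : G) : ofGroup α g ∈ unitary (CrossedProduct α) := by
  refine Unitary.mem_iff.2 ⟨?_, ?_⟩
  · refine Subtype.ext (Subtype.ext (funext fun ρ => ?_))
    exact Unitary.coe_star_mul_self (ρ.W g)
  · refine Subtype.ext (Subtype.ext (funext fun ρ => ?_))
    exact Unitary.coe_mul_star_self (ρ.W g)

theorem ofGroup_mul (g h : G) : ofGroup α g * ofGroup α h = ofGroup α (g * h) := by
  refine Subtype.ext (Subtype.ext (funext fun ρ => ?_))
  exact (congrArg Subtype.val (map_mul ρ.W g h)).symm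

theorem ofGroup_one : ofGroup α 1 = 1 := by
  refine Subtype.ext (Subtype.ext (funext fun ρ => ?_))
  exact congrArg Subtype.val (map_one ρ.W)

theorem ofGroup_mul_ofAlgebra (g : G) (a : A) :
    ofGroup α g * ofAlgebra α a = ofAlgebra α (α g a) * ofGroup α g := by
  refine Subtype.ext (Subtype.ext (funext fun ρ => ?_))
  change (ρ.W g : ρ.H →L[ℂ] ρ.H) * ρ.π a = ρ.π (α g a) * (ρ.W g : ρ.H →L[ℂ] ρ.H)
  rw [← ρ.covariant, mul_assoc _ _ (ρ.W g : ρ.H →L[ℂ] ρ.H), Unitary.coe_star_mul_self, mul_one]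

/-- The representation of `A ⋊ G` given by a covariant representation. -/
noncomputable def eval (ρ : CovariantRep α) : CrossedProduct α →⋆ₐ[ℂ] (ρ.H →L[ℂ] ρ.H) :=
  (boundedProductEval (B := fun ρ : CovariantRep α => ρ.H →L[ℂ] ρ.H) ρ).comp
    (generatedCStar (Set.range (CovariantRep.univπ α) ∪ Set.range (CovariantRep.univW α))).subtype

theorem eval_ofAlgebra (ρ : CovariantRep α) (a : A) : eval ρ (ofAlgebra α a) = ρ.π a := rfl

theorem eval_ofGroup (ρ : CovariantRep α) (g : G) : eval ρ (ofGroup α g) = ρ.W g := rfl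

open SemidirectProduct

variable {N : Type*} [Group N] {σ : N → N → Circle} {act : G →* MulAut N}

/-- Moving the unitary of `g` past `R_y` replaces it by `R_{g • y}`, and multiplying by `R_x` then
produces the phase `σ(x, g • y)`, which is `σ̃`. -/
theorem isProjRep (hσ : IsMultiplier σ) (e : TwistedGroupCStar σ ≃⋆ₐ[ℂ] A)
    (hα : ∀ g x, α g (e (TwistedGroupCStar.R σ x)) = e (TwistedGroupCStar.R σ (act g x))) :
    IsProjRep (semidirectTwist act σ) (fun x : N ⋊[act] G =>
      ofAlgebra α (e (TwistedGroupCStar.R σ x.left)) * ofGroup α x.right) where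
  mem_unitary x := by
    refine mul_mem ?_ (ofGroup_mem_unitary _)
    exact ((isProjRep_R hσ).map ((ofAlgebra α).comp (e : TwistedGroupCStar σ →⋆ₐ[ℂ] A))).mem_unitary
      x.left
  mul x y := by
    rw [mul_assoc, ← mul_assoc (ofGroup α x.right), ofGroup_mul_ofAlgebra, hα, mul_assoc,
      ofGroup_mul, ← mul_assoc, ← map_mul, ← map_mul, (isProjRep_R hσ).mul, map_smul, map_smul,
      smul_mul_assoc]
    rfl

/-- The regular representation of `N ⋊ G`, restricted to the two factors, is covariant. The copy `Γ`
of `N ⋊ G` serves only to put its Hilbert space in the universe required by `CovariantRep`. -/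
theorem exists_covariantRep {Γ : Type (max u v)} [Group Γ] (j : Γ ≃* N ⋊[act] G)
    (hN : IsFolner N) (hσ : IsMultiplier σ) (hact : ∀ g x y, σ (act g x) (act g y) = σ x y)
    (e : TwistedGroupCStar σ ≃⋆ₐ[ℂ] A)
    (hα : ∀ g x, α g (e (TwistedGroupCStar.R σ x)) = e (TwistedGroupCStar.R σ (act g x)))
    {τ : Γ → Γ → Circle} (hτ : ∀ x y, semidirectTwist act σ (j x) (j y) = τ x y) :
    ∃ f : CrossedProduct α →⋆ₐ[ℂ] (ell2 Γ →L[ℂ] ell2 Γ), ∀ x g,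
      f (ofAlgebra α (e (TwistedGroupCStar.R σ x)) * ofGroup α g) =
        twistedTranslation τ (j.symm (inl x * inr g)) := by
  have hτm : IsMultiplier τ := (hσ.semidirectTwist act hact).comp_mulEquiv j hτ
  have hu : IsProjRep (semidirectTwist act σ) (fun y => twistedTranslation τ (j.symm y)) := by
    have := (isProjRep_twistedTranslation hτm).comp_mulEquiv j.symm
    simpa only [← hτ, MulEquiv.apply_symm_apply] using this
  obtain ⟨p, hp⟩ := TwistedGroupCStar.exists_hom hN hσ hu.comp_inl
  let W := hu.restrictRight hσ
  have hcov : ∀ g, (Unitary.conjStarAlgAut ℂ _ (W g) :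
        (ell2 Γ →L[ℂ] ell2 Γ) →⋆ₐ[ℂ] (ell2 Γ →L[ℂ] ell2 Γ)).comp p =
      p.comp ((e.symm : A →⋆ₐ[ℂ] TwistedGroupCStar σ).comp
        ((α g : A →⋆ₐ[ℂ] A).comp (e : TwistedGroupCStar σ →⋆ₐ[ℂ] A))) := by
    intro g
    refine TwistedGroupCStar.hom_ext fun x => ?_
    change (W g : ell2 Γ →L[ℂ] ell2 Γ) * p (TwistedGroupCStar.R σ x) *
      star (W g : ell2 Γ →L[ℂ] ell2 Γ) = p (e.symm (α g (e (TwistedGroupCStar.R σ x))))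
    rw [hα, StarAlgEquiv.symm_apply_apply, hp, hp]
    have h := hu.inr_mul_inl hσ x g
    change (W g : ell2 Γ →L[ℂ] ell2 Γ) * _ = _ * (W g : ell2 Γ →L[ℂ] ell2 Γ) at h
    rw [h, mul_assoc, Unitary.mul_star_self_of_mem (W g).2, mul_one]
  let ρ : CovariantRep α :=
    { H := ell2 Γ
      π := p.comp (e.symm : A →⋆ₐ[ℂ] TwistedGroupCStar σ)
      W := W
      covariant := fun g a => by
        have h := DFunLike.congr_fun (hcov g) (e.symm a)
        change (W g : ell2 Γ →L[ℂ] ell2 Γ) * p (e.symm a) * star (W g : ell2 Γ →L[ℂ] ell2 Γ) =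
          p (e.symm (α g (e (e.symm a)))) at h
        rw [StarAlgEquiv.apply_symm_apply] at h
        exact h }
  refine ⟨eval ρ, fun x g => ?_⟩
  rw [map_mul, eval_ofAlgebra, eval_ofGroup]
  change p (e.symm (e (TwistedGroupCStar.R σ x))) * twistedTranslation τ (j.symm (inr g)) = _
  rw [StarAlgEquiv.symm_apply_apply, hp]
  exact hu.inl_mul_inr hσ x g

theorem nonempty_equiv_twistedGroupCStar {Γ : Type (max u v)} [Group Γ] (j : Γ ≃* N ⋊[act] G)
    (hN : IsFolner N) (hG : IsFolner G) (hσ : IsMultiplier σ)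
    (hact : ∀ g x y, σ (act g x) (act g y) = σ x y)
    (e : TwistedGroupCStar σ ≃⋆ₐ[ℂ] A)
    (hα : ∀ g x, α g (e (TwistedGroupCStar.R σ x)) = e (TwistedGroupCStar.R σ (act g x))) :
    Nonempty (CrossedProduct α ≃⋆ₐ[ℂ]
      TwistedGroupCStar (Γ := N ⋊[act] G) (semidirectTwist act σ)) := by
  have hNG := hN.semidirectProduct hG act
  have hσ' := hσ.semidirectTwist act hact
  obtain ⟨Φ, hΦ⟩ := TwistedGroupCStar.exists_hom hNG hσ' (isProjRep hσ e hα)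
  let τ : Γ → Γ → Circle := fun x y => semidirectTwist act σ (j x) (j y)
  have hτm : IsMultiplier τ := hσ'.comp_mulEquiv j fun _ _ => rfl
  obtain ⟨f, hf⟩ := exists_covariantRep j hN hσ hact e hα (τ := τ) fun _ _ => rfl
  obtain ⟨q, hq⟩ := TwistedGroupCStar.exists_equiv hNG hτm j.symm
    (σ := semidirectTwist act σ) fun x y => by
      simp only [τ, MulEquiv.apply_symm_apply]
  -- Followed by the regular covariant representation, `Φ` becomes the faithful regular
  -- representation, up to renaming the group; hence `Φ` is injective.
  have hcomp : f.comp Φ = (TwistedGroupCStar.regular τ).comp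
      (q : TwistedGroupCStar (semidirectTwist act σ) →⋆ₐ[ℂ] TwistedGroupCStar τ) := by
    refine TwistedGroupCStar.hom_ext fun x => ?_
    rw [StarAlgHom.comp_apply, hΦ, hf, inl_left_mul_inr_right]
    change _ = TwistedGroupCStar.regular τ (q (TwistedGroupCStar.R _ x))
    rw [hq, TwistedGroupCStar.regular_R]
  have hinj : Function.Injective Φ := by
    have h : Function.Injective (f.comp Φ) := by
      rw [hcomp]
      exact TwistedGroupCStar.regular_injective.comp q.injective
    exact Function.Injective.of_comp (f := f) h
  have hsurj : Function.Surjective Φ := by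
    refine surjective_of_generators_mem_range
      (s := Set.range (CovariantRep.univπ α) ∪ Set.range (CovariantRep.univW α)) Φ hinj ?_
    rintro _ (⟨a, rfl⟩ | ⟨g, rfl⟩)
    -- An arbitrary element of `A` is reached through the map `p` of `C*(N, σ)` into `C*(N ⋊ G,
    -- σ̃)`: `Φ ∘ p` agrees with the canonical embedding on generators.
    · obtain ⟨p, hp⟩ := TwistedGroupCStar.exists_hom hN hσ (isProjRep_R hσ').comp_inl
      have h : Φ.comp p = (ofAlgebra α).comp (e : TwistedGroupCStar σ →⋆ₐ[ℂ] A) := by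
        refine TwistedGroupCStar.hom_ext fun x => ?_
        rw [StarAlgHom.comp_apply, hp, hΦ, left_inl, right_inl, ofGroup_one, mul_one]
        rfl
      refine ⟨p (e.symm a), (DFunLike.congr_fun h (e.symm a)).trans ?_⟩
      change ofAlgebra α (e (e.symm a)) = _
      rw [StarAlgEquiv.apply_symm_apply]
      rfl
    · refine ⟨TwistedGroupCStar.R _ (inr g), (hΦ _).trans ?_⟩
      rw [left_inr, right_inr, (isProjRep_R hσ).map_one hσ, map_one, map_one, one_mul]
      rfl
  exact ⟨(StarAlgEquiv.ofBijective Φ ⟨hinj, hsurj⟩).symm⟩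

end CrossedProduct

/-! ## The multiplier `σ_θ` on `ℤ²` -/

theorem sigmaZ_isMultiplier (t : ℝ) : IsMultiplier (sigmaZ t) where
  one_left x := by simp [sigmaZ]
  one_right x := by simp [sigmaZ]
  cocycle x y z := by
    simp only [sigmaZ, ← Circle.exp_add, toAdd_mul, Pi.add_apply, Int.cast_add]
    congr 1
    ring

/-- The automorphisms of `N` preserving `σ`. -/
def multiplierStabilizer {N : Type*} [Group N] (σ : N → N → Circle) : Subgroup (MulAut N) where
  carrier := {f | ∀ x y, σ (f x) (f y) = σ x y}
  one_mem' _ _ := rfl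
  mul_mem' hf hg x y := (hf _ _).trans (hg x y)
  inv_mem' := fun {f} hf x y => by
    rw [← hf (f⁻¹ x) (f⁻¹ y), MulAut.apply_inv_self, MulAut.apply_inv_self]

/-- The exponent is `πt` times the determinant with rows `x` and `y`, which right multiplication by
`φ` scales by `det φ = 1`. -/
theorem sigmaZ_rowAut (t : ℝ) (φ : Matrix.SpecialLinearGroup (Fin 2) ℤ) (x y : ZSq) :
    sigmaZ t (rowAut φ x) (rowAut φ y) = sigmaZ t x y := by
  have hdet : φ.1 0 0 * φ.1 1 1 - φ.1 0 1 * φ.1 1 0 = 1 := by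
    rw [← Matrix.det_fin_two]
    exact φ.2
  have hdet' : (φ.1 0 0 * φ.1 1 1 - φ.1 0 1 * φ.1 1 0 : ℝ) = 1 := by exact_mod_cast hdet
  have h : ∀ (x : ZSq) (i : Fin 2), ((rowAut φ x).toAdd i : ℝ) =
      x.toAdd 0 * φ.1 0 i + x.toAdd 1 * φ.1 1 i := by
    intro x i
    change ((Matrix.vecMul x.toAdd φ.1 i : ℤ) : ℝ) = _
    simp [Matrix.vecMul, dotProduct, Fin.sum_univ_two]
  simp only [sigmaZ, h]
  congr 1
  linear_combination (Real.pi * t * (x.toAdd 0 * y.toAdd 1 - x.toAdd 1 * y.toAdd 0)) * hdet'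

theorem sigmaZ_rowAction (t : ℝ) (φ : Matrix.SpecialLinearGroup (Fin 2) ℤ)
    (k : Multiplicative ℤ) (x y : ZSq) :
    sigmaZ t (rowAction φ k x) (rowAction φ k y) = sigmaZ t x y := by
  have h : rowAction φ k ∈ multiplierStabilizer (sigmaZ t) := by
    rw [rowAction, zpowersHom_apply]
    exact zpow_mem (show rowAut φ ∈ multiplierStabilizer (sigmaZ t) from sigmaZ_rowAut t φ) _
  exact h x y

/-- `ℤ²` as a (trivial) semidirect product. -/
def zSqEquiv : Multiplicative ℤ ⋊[(1 : Multiplicative ℤ →* MulAut (Multiplicative ℤ))]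
    Multiplicative ℤ ≃* ZSq where
  toFun p := .ofAdd ![p.left.toAdd, p.right.toAdd]
  invFun x := ⟨.ofAdd (x.toAdd 0), .ofAdd (x.toAdd 1)⟩
  left_inv _ := rfl
  right_inv x := by
    apply Multiplicative.toAdd.injective
    ext i
    fin_cases i <;> rfl
  map_mul' p q := by
    apply Multiplicative.toAdd.injective
    ext i
    fin_cases i <;> rfl

theorem IsFolner.zSq : IsFolner ZSq :=
  (IsFolner.int.semidirectProduct IsFolner.int 1).of_mulEquiv zSqEquiv

/-! ## The Weyl unitaries of a pair of unitaries -/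

/-- Conjugating by `V` multiplies `U` by `c`, hence `U ^ m` by `c ^ m`. Read as a conjugation of `V`
by `U ^ m`, this can be raised to the power `n`. -/
theorem zpow_mul_zpow_of_mul_eq {H : Type*} [Group H] {U V c : H} (hU : Commute c U)
    (hV : Commute c V) (h : V * U = c * (U * V)) (n m : ℤ) :
    V ^ n * U ^ m = c ^ (n * m) * (U ^ m * V ^ n) := by
  have h1 : V * U * V⁻¹ = c * U := by rw [h, ← mul_assoc, mul_inv_cancel_right]
  have h2 : V * U ^ m * V⁻¹ = c ^ m * U ^ m := by rw [← conj_zpow, h1, hU.mul_zpow]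
  have h3 : (U ^ m)⁻¹ * V * U ^ m = c ^ m * V := by
    have hc : Commute (c ^ m) (U ^ m) := hU.zpow_zpow m m
    calc (U ^ m)⁻¹ * V * U ^ m = (U ^ m)⁻¹ * (V * U ^ m * V⁻¹) * V := by group
      _ = _ := by rw [h2, hc.eq, inv_mul_cancel_left]
  have h4 : (U ^ m)⁻¹ * V ^ n * U ^ m = c ^ (n * m) * V ^ n := by
    have h5 := conj_zpow (a := (U ^ m)⁻¹) (b := V) (i := n)
    rw [inv_inv, h3, (hV.zpow_left m).mul_zpow, ← zpow_mul, mul_comm m n] at h5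
    exact h5.symm
  have hc : Commute (c ^ (n * m)) (U ^ m) := hU.zpow_zpow _ m
  calc V ^ n * U ^ m = U ^ m * ((U ^ m)⁻¹ * V ^ n * U ^ m) := by group
    _ = _ := by rw [h4, ← mul_assoc, ← hc.eq, mul_assoc]

section Pair

variable {B C : Type*} [CStarAlgebra B] [CStarAlgebra C]

/-- The scalar unitaries of a C*-algebra. -/
noncomputable def scalarUnitary (B : Type*) [CStarAlgebra B] : Circle →* unitary B where
  toFun z := ⟨(z : ℂ) • 1, Unitary.mem_iff.2 (by
    constructor
    · rw [star_smul, star_one, smul_mul_smul_comm, Circle.star_coe_mul_coe, one_smul, one_mul]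
    · rw [star_smul, star_one, smul_mul_smul_comm, mul_comm, Circle.star_coe_mul_coe, one_smul,
        one_mul])⟩
  map_one' := Subtype.ext (by simp)
  map_mul' z w := Subtype.ext (by simp [smul_smul, mul_comm])

theorem coe_scalarUnitary_mul (z : Circle) (u : unitary B) :
    ((scalarUnitary B z * u : unitary B) : B) = (z : ℂ) • (u : B) :=
  smul_one_mul (z : ℂ) (u : B)

theorem scalarUnitary_commute (z : Circle) (u : unitary B) : Commute (scalarUnitary B z) u :=
  Subtype.ext ((smul_one_mul (z : ℂ) (u : B)).trans (mul_smul_one (z : ℂ) (u : B)).symm)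

/-- The unitaries `e^{-πitnm} V^n U^m`. -/
noncomputable def weylUnitary (t : ℝ) (U V : unitary B) (x : ZSq) : unitary B :=
  scalarUnitary B (Circle.exp (-(Real.pi * t * x.toAdd 0 * x.toAdd 1))) *
    (V ^ x.toAdd 0 * U ^ x.toAdd 1)

theorem coe_weylUnitary (t : ℝ) (U V : unitary B) (x : ZSq) : (weylUnitary t U V x : B) =
    (Circle.exp (-(Real.pi * t * x.toAdd 0 * x.toAdd 1)) : ℂ) •
      ((V ^ x.toAdd 0 * U ^ x.toAdd 1 : unitary B) : B) :=
  coe_scalarUnitary_mul _ _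

/-- Reordering `U ^ m V ^ k` costs `e^{-2πitkm}`. The normalizing factors turn this into the
antisymmetric phase, because `-nm - kr - 2km = (nr - mk) - (n + k)(m + r)`. -/
theorem weylUnitary_mul {t : ℝ} {U V : unitary B}
    (h : V * U = scalarUnitary B (Circle.exp (2 * Real.pi * t)) * (U * V)) (x y : ZSq) :
    weylUnitary t U V x * weylUnitary t U V y =
      scalarUnitary B (sigmaZ t x y) * weylUnitary t U V (x * y) := by
  have hcomm := zpow_mul_zpow_of_mul_eq (scalarUnitary_commute _ U) (scalarUnitary_commute _ V) h
  have hsc : ∀ (z : Circle) (u : unitary B), scalarUnitary B z * u = u * scalarUnitary B z := fun z u => scalarUnitary_commute z u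
  simp only [weylUnitary, toAdd_mul, Pi.add_apply, zpow_add]
  generalize hn : x.toAdd 0 = n
  generalize hm : x.toAdd 1 = m
  generalize hk : y.toAdd 0 = k
  generalize hr : y.toAdd 1 = r
  have h1 : U ^ m * V ^ k = scalarUnitary B (Circle.exp (-(2 * Real.pi * t * (k * m)))) * (V ^ k * U ^ m) := by
    rw [hcomm k m, ← map_zpow, ← Circle.exp_zsmul, ← mul_assoc, ← map_mul, ← Circle.exp_add]
    have : -(2 * Real.pi * t * (k * m)) + (k * m) • (2 * Real.pi * t) = 0 := by
      rw [zsmul_eq_mul]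
      push_cast
      ring
    rw [this, Circle.exp_zero, map_one, one_mul]
  have h2 : ∀ (a b c : Circle) (p q v w : unitary B),
      q * v = scalarUnitary B c * (v * q) →
      scalarUnitary B a * (p * q) * (scalarUnitary B b * (v * w)) = scalarUnitary B (a * b * c) * (p * v * (q * w)) := by
    intro a b c p q v w hqv
    calc scalarUnitary B a * (p * q) * (scalarUnitary B b * (v * w)) = scalarUnitary B a * ((p * q) * scalarUnitary B b) * (v * w) := by
          simp only [mul_assoc]
      _ = scalarUnitary B a * (scalarUnitary B b * (p * q)) * (v * w) := by rw [← hsc b (p * q)]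
      _ = scalarUnitary B a * scalarUnitary B b * (p * (q * v) * w) := by simp only [mul_assoc]
      _ = scalarUnitary B a * scalarUnitary B b * ((p * scalarUnitary B c) * (v * q) * w) := by rw [hqv]; simp only [mul_assoc]
      _ = scalarUnitary B a * scalarUnitary B b * ((scalarUnitary B c * p) * (v * q) * w) := by rw [← hsc c p]
      _ = _ := by rw [map_mul, map_mul]; simp only [mul_assoc]
  rw [h2 _ _ _ _ _ _ _ h1, ← mul_assoc (scalarUnitary B (sigmaZ t x y)),
    ← (scalarUnitary B).map_mul]
  congr 2
  simp only [sigmaZ, hn, hm, hk, hr, ← Circle.exp_add]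
  congr 1
  push_cast
  ring

theorem isProjRep_weylUnitary {t : ℝ} {U V : unitary B}
    (h : V * U = scalarUnitary B (Circle.exp (2 * Real.pi * t)) * (U * V)) :
    IsProjRep (sigmaZ t) (fun x => (weylUnitary t U V x : B)) where
  mem_unitary x := (weylUnitary t U V x).2
  mul x y := by
    rw [← coe_scalarUnitary_mul, ← weylUnitary_mul h]
    rfl

theorem map_weylUnitary (f : B →⋆ₐ[ℂ] C) (t : ℝ) (U V : unitary B) (x : ZSq) :
    f (weylUnitary t U V x) = weylUnitary t (Unitary.map (.ofClass f) U)
      (Unitary.map (.ofClass f) V) x := by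
  rw [coe_weylUnitary, coe_weylUnitary, map_smul, ← map_zpow, ← map_zpow, ← map_mul]
  rfl

/-- A `σ_t`-projective representation of `ℤ²` is given by the Weyl unitaries of its values on
the standard basis. -/
theorem IsProjRep.eq_weylUnitary {t : ℝ} {u : ZSq → B} (hu : IsProjRep (sigmaZ t) u) (x : ZSq) :
    u x = weylUnitary t ⟨u (.ofAdd ![0, 1]), hu.mem_unitary _⟩
      ⟨u (.ofAdd ![1, 0]), hu.mem_unitary _⟩ x := by
  have hpow : ∀ v : Fin 2 → ℤ, ∀ k : ℤ,
      (⟨u (.ofAdd (k • v)), hu.mem_unitary _⟩ : unitary B) =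
        ⟨u (.ofAdd v), hu.mem_unitary _⟩ ^ k := by
    intro v k
    let g : Multiplicative ℤ →* unitary B :=
      MonoidHom.mk' (fun k => ⟨u (.ofAdd (k.toAdd • v)), hu.mem_unitary _⟩) fun a b => by
        refine Subtype.ext ?_
        change u _ = u _ * u _
        -- The alternating form vanishes on multiples of one vector, so `u` is an honest
        -- homomorphism on each line.
        have h1 : sigmaZ t (.ofAdd (a.toAdd • v)) (.ofAdd (b.toAdd • v)) = 1 := by
          have : (Real.pi * t * (((a.toAdd • v) 0 : ℤ) * ((b.toAdd • v) 1 : ℤ) -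
              ((a.toAdd • v) 1 : ℤ) * ((b.toAdd • v) 0 : ℤ)) : ℝ) = 0 := by
            simp only [Pi.smul_apply, smul_eq_mul]
            push_cast
            ring
          exact (congrArg Circle.exp this).trans Circle.exp_zero
        rw [hu.mul, h1, Circle.coe_one, one_smul, toAdd_mul, add_smul, ofAdd_add]
    have h2 : g (.ofAdd k) = g (.ofAdd 1) ^ k := by
      rw [← map_zpow, ← ofAdd_zsmul, smul_eq_mul, mul_one]
    have h3 : g (.ofAdd 1) = ⟨u (.ofAdd v), hu.mem_unitary _⟩ := by
      refine Subtype.ext ?_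
      change u (.ofAdd ((1 : ℤ) • v)) = _
      rw [one_smul]
    rw [← h3, ← h2]
    rfl
  rw [coe_weylUnitary, ← hpow, ← hpow]
  change _ = _ • (u _ * u _)
  have hx : (.ofAdd (x.toAdd 0 • ![1, 0]) * .ofAdd (x.toAdd 1 • ![0, 1]) : ZSq) = x := by
    apply Multiplicative.toAdd.injective
    ext i
    fin_cases i <;> simp
  rw [hu.mul, hx, smul_smul, ← Circle.coe_mul, sigmaZ, ← Circle.exp_add]
  -- The phase `σ_t((n, 0), (0, m)) = e^{πitnm}` cancels the normalizing factor of the Weyl unitary.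
  have h0 : -(Real.pi * t * x.toAdd 0 * x.toAdd 1) + Real.pi * t *
      (((Multiplicative.ofAdd (x.toAdd 0 • ![1, 0]) : ZSq).toAdd 0 : ℤ) *
        ((Multiplicative.ofAdd (x.toAdd 1 • ![0, 1]) : ZSq).toAdd 1 : ℤ) -
      ((Multiplicative.ofAdd (x.toAdd 0 • ![1, 0]) : ZSq).toAdd 1 : ℤ) *
        ((Multiplicative.ofAdd (x.toAdd 1 • ![0, 1]) : ZSq).toAdd 0 : ℤ)) = 0 := by
    simp
    ring
  rw [h0, Circle.exp_zero, Circle.coe_one, one_smul]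

end Pair

/-! ## Noncommutative tori as twisted group C*-algebras -/

namespace NCTorus

theorem weyl_eq (t : ℝ) (x : ZSq) : weyl t x = weylUnitary t (U t) (V t) x :=
  (coe_weylUnitary _ _ _ _).symm

theorem V_mul_U (t : ℝ) :
    V t * U t = scalarUnitary (NCTorus t) (Circle.exp (2 * Real.pi * t)) * (U t * V t) := by
  refine Subtype.ext ?_
  rw [coe_scalarUnitary_mul]
  refine Subtype.ext (Subtype.ext (funext fun ρ => ?_))
  exact ρ.relation

theorem isProjRep_weyl (t : ℝ) : IsProjRep (sigmaZ t) (weyl t) := by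
  have := isProjRep_weylUnitary (V_mul_U t)
  simpa only [← weyl_eq] using this

/-- The representation of `𝒜_t` given by a pair of unitaries. -/
noncomputable def eval {t : ℝ} (ρ : RotationPair t) : NCTorus t →⋆ₐ[ℂ] (ρ.H →L[ℂ] ρ.H) :=
  (boundedProductEval (B := fun ρ : RotationPair t => ρ.H →L[ℂ] ρ.H) ρ).comp
    (generatedCStar {(univU t : RotationPair.Ambient t), (univV t : RotationPair.Ambient t)}).subtype

/-- The pair of unitaries on `ℓ²(ℤ²)` given by the regular representation. -/
noncomputable def regularPair (t : ℝ) : RotationPair t where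
  H := ell2 ZSq
  U := ⟨twistedTranslation (sigmaZ t) (.ofAdd ![0, 1]),
    twistedTranslation_mem_unitary (sigmaZ_isMultiplier t) _⟩
  V := ⟨twistedTranslation (sigmaZ t) (.ofAdd ![1, 0]),
    twistedTranslation_mem_unitary (sigmaZ_isMultiplier t) _⟩
  relation := by
    change twistedTranslation (sigmaZ t) _ * twistedTranslation (sigmaZ t) _ =
      _ • (twistedTranslation (sigmaZ t) _ * twistedTranslation (sigmaZ t) _)
    rw [twistedTranslation_mul (sigmaZ_isMultiplier t),
      twistedTranslation_mul (sigmaZ_isMultiplier t), smul_smul, ← Circle.coe_mul, mul_comm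
      (Multiplicative.ofAdd ![0, 1] : ZSq)]
    congr 2
    simp only [sigmaZ, ← Circle.exp_add]
    congr 1
    simp
    ring

theorem eval_weyl (t : ℝ) (x : ZSq) :
    eval (regularPair t) (weyl t x) = twistedTranslation (sigmaZ t) x := by
  rw [weyl_eq, map_weylUnitary,
    (isProjRep_twistedTranslation (sigmaZ_isMultiplier t)).eq_weylUnitary x]
  rfl

theorem exists_equiv (t : ℝ) : ∃ e : TwistedGroupCStar (sigmaZ t) ≃⋆ₐ[ℂ] NCTorus t,
    ∀ x, e (TwistedGroupCStar.R (sigmaZ t) x) = weyl t x := by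
  obtain ⟨Φ, hΦ⟩ := TwistedGroupCStar.exists_hom IsFolner.zSq (sigmaZ_isMultiplier t)
    (isProjRep_weyl t)
  -- The regular pair is one of the representations defining `𝒜_t`, so evaluating there recovers the
  -- regular representation and forces `Φ` to be injective.
  have hcomp : (eval (regularPair t)).comp Φ = TwistedGroupCStar.regular (sigmaZ t) := by
    refine TwistedGroupCStar.hom_ext fun x => ?_
    rw [StarAlgHom.comp_apply, hΦ, eval_weyl]
    rfl
  have hinj : Function.Injective Φ := by
    have h : Function.Injective ((eval (regularPair t)).comp Φ) := by
      rw [hcomp]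
      exact TwistedGroupCStar.regular_injective
    exact Function.Injective.of_comp (f := eval (regularPair t)) h
  have hsurj : Function.Surjective Φ := by
    refine surjective_of_generators_mem_range
      (s := {(univU t : RotationPair.Ambient t), (univV t : RotationPair.Ambient t)}) Φ hinj ?_
    rintro _ (rfl | rfl)
    · refine ⟨TwistedGroupCStar.R _ (.ofAdd ![0, 1]), (hΦ _).trans ?_⟩
      change weyl t _ = (U t : NCTorus t)
      simp [weyl]
    · refine ⟨TwistedGroupCStar.R _ (.ofAdd ![1, 0]), (hΦ _).trans ?_⟩
      change weyl t _ = (V t : NCTorus t)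
      simp [weyl]
  exact ⟨StarAlgEquiv.ofBijective Φ ⟨hinj, hsurj⟩, hΦ⟩

end NCTorus

/-! ## The lattice `Λ` of a real quadratic field -/

section Quadratic

variable {K : Type*} [Field K]

theorem mem_latticeL_iff {θ x : K} : x ∈ latticeL θ ↔ ∃ n m : ℤ, x = n + m * θ := by
  rw [latticeL, AddSubgroup.mem_closure_pair]
  simp only [zsmul_eq_mul, mul_one, eq_comm]

theorem intCast_add_mul_injective [CharZero K] {θ : K} (hθ : θ ∉ Set.range (algebraMap ℚ K))
    {n m k r : ℤ} (h : (n : K) + m * θ = k + r * θ) : n = k ∧ m = r := by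
  have hm : m = r := by
    by_contra hne
    have h0 : (m : K) - r ≠ 0 := sub_ne_zero.2 (Int.cast_injective.ne hne)
    refine hθ ⟨((k - n : ℤ) : ℚ) / ((m - r : ℤ) : ℚ), ?_⟩
    rw [map_div₀, map_intCast, map_intCast, Int.cast_sub, Int.cast_sub, div_eq_iff h0]
    linear_combination -h
  subst hm
  exact ⟨Int.cast_injective (add_right_cancel h), rfl⟩

/-- The pair `(1, θ)` is a `ℚ`-basis of `K`, so embeddings agreeing at `θ` coincide. -/
theorem embedding_apply_ne [NumberField K] (hK : Module.finrank ℚ K = 2) {ι : Fin 2 → K →+* ℝ}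
    (hι : Function.Injective ι) {θ : K} (hθ : θ ∉ Set.range (algebraMap ℚ K)) :
    ι 0 θ ≠ ι 1 θ := by
  intro h
  have hli : LinearIndependent ℚ ![1, θ] := by
    rw [LinearIndependent.pair_iff' one_ne_zero]
    intro a ha
    exact hθ ⟨a, by rw [← ha, Algebra.smul_def, mul_one]⟩
  have hspan := hli.span_eq_top_of_card_eq_finrank' (by rw [hK, Fintype.card_fin])
  have heq : ι 0 = ι 1 := by
    ext x
    have hx : x ∈ Submodule.span ℚ (Set.range ![1, θ]) := hspan ▸ Submodule.mem_top
    rw [Matrix.range_cons, Matrix.range_cons, Matrix.range_empty, Set.union_empty,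
      Set.singleton_union, Submodule.mem_span_pair] at hx
    obtain ⟨a, b, rfl⟩ := hx
    simp only [Algebra.smul_def, map_add, map_mul, map_one, h, eq_ratCast, map_ratCast]
  exact zero_ne_one (hι heq)

variable (ι : Fin 2 → K →+* ℝ) (θ : K)

/-- The homomorphism `(n, m) ↦ (ι₁, ι₂)(n + mθ)` of `ℤ²` onto `Λ`. -/
noncomputable def zSqToLattice : ZSq →* Multiplicative (latticeΛ ι θ) :=
  MonoidHom.mk' (fun x => .ofAdd ⟨embR2 ι (x.toAdd 0 + x.toAdd 1 * θ),
    ⟨_, mem_latticeL_iff.2 ⟨_, _, rfl⟩, rfl⟩⟩) fun x y => by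
      apply Multiplicative.toAdd.injective
      refine Subtype.ext ?_
      change embR2 ι _ = embR2 ι _ + embR2 ι _
      rw [← map_add]
      congr 1
      simp only [toAdd_mul, Pi.add_apply, Int.cast_add]
      ring

variable {ι θ}

theorem coe_zSqToLattice (x : ZSq) : ((zSqToLattice ι θ x).toAdd : ℝ × ℝ) =
    embR2 ι (x.toAdd 0 + x.toAdd 1 * θ) := rfl

theorem embR2_injective : Function.Injective (embR2 ι) := fun _ _ h =>
  (ι 0).injective (congrArg Prod.fst h)

theorem zSqToLattice_bijective [CharZero K] (hθ : θ ∉ Set.range (algebraMap ℚ K)) :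
    Function.Bijective (zSqToLattice ι θ) := by
  constructor
  · intro x y h
    have h1 := embR2_injective (congrArg (fun p => (p.toAdd : ℝ × ℝ)) h)
    obtain ⟨h2, h3⟩ := intCast_add_mul_injective hθ h1
    apply Multiplicative.toAdd.injective
    ext i
    fin_cases i
    · exact h2
    · exact h3
  · rintro ⟨_, l, hl, rfl⟩
    obtain ⟨n, m, rfl⟩ := mem_latticeL_iff.1 hl
    refine ⟨.ofAdd ![n, m], Multiplicative.toAdd.injective (Subtype.ext ?_)⟩
    rfl

/-- The wedge of the images of `(n, m)` and `(k, r)` is `(nr - mk)(θ' - θ)`, which explains the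
factor `(θ' - θ)⁻¹` in `u`. -/
theorem sigmaΛ_zSqToLattice (hne : ι 0 θ ≠ ι 1 θ) (s : ℝ) (x y : ZSq) :
    sigmaΛ ι θ (s * (ι 1 θ - ι 0 θ)⁻¹) (zSqToLattice ι θ x) (zSqToLattice ι θ y) =
      sigmaZ s x y := by
  have h0 : ι 1 θ - ι 0 θ ≠ 0 := sub_ne_zero.2 hne.symm
  have h1 : ∀ x : ZSq, ((zSqToLattice ι θ x).toAdd : ℝ × ℝ) =
      (x.toAdd 0 + x.toAdd 1 * ι 0 θ, x.toAdd 0 + x.toAdd 1 * ι 1 θ) := by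
    intro x
    rw [coe_zSqToLattice]
    simp [embR2]
  rw [sigmaΛ, sigmaZ, h1, h1]
  congr 1
  field_simp
  ring

/-- A totally positive unit preserving `L` acts on the basis `(1, θ)` by an integral matrix of
determinant one. -/
theorem exists_specialLinearGroup [CharZero K] (hne : ι 0 θ ≠ ι 1 θ)
    (ε : totallyPositiveUnits ι θ) :
    ∃ φ : Matrix.SpecialLinearGroup (Fin 2) ℤ,
      ((ε : (𝓞 K)ˣ) : K) = φ.1 0 0 + φ.1 0 1 * θ ∧
        ((ε : (𝓞 K)ˣ) : K) * θ = φ.1 1 0 + φ.1 1 1 * θ := by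
  have key : ∀ w : totallyPositiveUnits ι θ, ∃ a b c d : ℤ,
      ((w : (𝓞 K)ˣ) : K) = a + b * θ ∧ ((w : (𝓞 K)ˣ) : K) * θ = c + d * θ ∧
      ((a * d - b * c : ℤ) : ℝ) = ι 0 (w : (𝓞 K)ˣ) * ι 1 (w : (𝓞 K)ˣ) := by
    intro w
    obtain ⟨a, b, hab⟩ := mem_latticeL_iff.1
      (w.2.1 1 (mem_latticeL_iff.2 ⟨1, 0, by simp⟩))
    obtain ⟨c, d, hcd⟩ := mem_latticeL_iff.1
      (w.2.1 θ (mem_latticeL_iff.2 ⟨0, 1, by simp⟩))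
    rw [mul_one] at hab
    refine ⟨a, b, c, d, hab, hcd, ?_⟩
    have e1 : ∀ i, ι i (w : (𝓞 K)ˣ) = a + b * ι i θ := fun i => by
      have := congrArg (ι i) hab
      simpa using this
    have e2 : ∀ i, ι i (w : (𝓞 K)ˣ) * ι i θ = c + d * ι i θ := fun i => by
      have := congrArg (ι i) hcd
      simpa using this
    have h0 : ι 1 θ - ι 0 θ ≠ 0 := sub_ne_zero.2 hne.symm
    -- The matrix of `w` times the matrix with rows `(1, 1)` and `(θ, θ')` equals the latter times
    -- `diag(ι₁ w, ι₂ w)`. Taking determinants and cancelling `θ' - θ` gives the norm of `w`.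
    refine mul_right_cancel₀ h0 ?_
    push_cast
    have h3 := e1 0
    have h4 := e1 1
    have h5 := e2 0
    have h6 := e2 1
    generalize ι 0 (w : (𝓞 K)ˣ) = p at *
    generalize ι 1 (w : (𝓞 K)ˣ) = q at *
    linear_combination (-(q * ι 1 θ)) * h3 + p * ι 0 θ * h4 + (a + b * ι 1 θ) * h5 -
      (a + b * ι 0 θ) * h6
  obtain ⟨a, b, c, d, hab, hcd, hdet⟩ := key ε
  obtain ⟨a', b', c', d', -, -, hdet'⟩ := key ε⁻¹
  have hinv : ∀ i, ι i (ε : (𝓞 K)ˣ) * ι i ((ε⁻¹ : totallyPositiveUnits ι θ) : (𝓞 K)ˣ) = 1 := by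
    intro i
    rw [← map_mul, ← map_mul, InvMemClass.coe_inv, Units.mul_inv, map_one, map_one]
  -- The determinants for `ε` and `ε⁻¹` are mutually inverse integers, so each is `±1`; total
  -- positivity excludes `-1`.
  have hprod : (a * d - b * c) * (a' * d' - b' * c') = 1 := by
    have : ((a * d - b * c : ℤ) : ℝ) * ((a' * d' - b' * c' : ℤ) : ℝ) = 1 := by
      rw [hdet, hdet', mul_mul_mul_comm, hinv, hinv, one_mul]
    exact_mod_cast this
  have hpos : 0 < a * d - b * c := by
    have : (0 : ℝ) < ((a * d - b * c : ℤ) : ℝ) := by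
      rw [hdet]
      exact mul_pos (ε.2.2 0) (ε.2.2 1)
    exact_mod_cast this
  have hone : a * d - b * c = 1 :=
    Int.eq_one_or_neg_one_of_mul_eq_one hprod |>.resolve_right (by omega)
  refine ⟨⟨!![a, b; c, d], by rw [Matrix.det_fin_two_of, hone]⟩, ?_, ?_⟩
  · simpa using hab
  · simpa using hcd

theorem unitAction_zSqToLattice {φ : Matrix.SpecialLinearGroup (Fin 2) ℤ}
    {ε : totallyPositiveUnits ι θ} (h1 : ((ε : (𝓞 K)ˣ) : K) = φ.1 0 0 + φ.1 0 1 * θ)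
    (h2 : ((ε : (𝓞 K)ˣ) : K) * θ = φ.1 1 0 + φ.1 1 1 * θ) (x : ZSq) :
    unitAction ι θ ε (zSqToLattice ι θ x) = zSqToLattice ι θ (rowAut φ x) := by
  apply Multiplicative.toAdd.injective
  refine Subtype.ext ?_
  rw [coe_zSqToLattice]
  have h : ((rowAut φ x).toAdd 0 : K) + (rowAut φ x).toAdd 1 * θ =
      (ε : (𝓞 K)ˣ) * (x.toAdd 0 + x.toAdd 1 * θ) := by
    change ((Matrix.vecMul x.toAdd φ.1 0 : ℤ) : K) + (Matrix.vecMul x.toAdd φ.1 1 : ℤ) * θ = _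
    simp only [Matrix.vecMul, dotProduct, Fin.sum_univ_two]
    push_cast
    linear_combination (-(x.toAdd 0 : K)) * h1 - x.toAdd 1 * h2
  rw [h]
  simp [unitAction, unitMap, coe_zSqToLattice, embR2]

theorem unitAction_zpow_zSqToLattice [CharZero K] (hθ : θ ∉ Set.range (algebraMap ℚ K))
    {φ : Matrix.SpecialLinearGroup (Fin 2) ℤ} {ε : totallyPositiveUnits ι θ}
    (h1 : ((ε : (𝓞 K)ˣ) : K) = φ.1 0 0 + φ.1 0 1 * θ)
    (h2 : ((ε : (𝓞 K)ˣ) : K) * θ = φ.1 1 0 + φ.1 1 1 * θ) (k : Multiplicative ℤ) (x : ZSq) :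
    unitAction ι θ (ε ^ k.toAdd) (zSqToLattice ι θ x) =
      zSqToLattice ι θ (rowAction φ k x) := by
  let j : ZSq ≃* Multiplicative (latticeΛ ι θ) :=
    MulEquiv.ofBijective (zSqToLattice ι θ) (zSqToLattice_bijective hθ)
  -- As automorphisms, the two actions are conjugate by `j`, and conjugation commutes with integer
  -- powers.
  have h : unitAction ι θ ε = MulAut.congr j (rowAut φ) := by
    ext1 p
    obtain ⟨x, rfl⟩ := j.surjective p
    change unitAction ι θ ε (zSqToLattice ι θ x) = j (rowAut φ (j.symm (j x)))
    rw [unitAction_zSqToLattice h1 h2, j.symm_apply_apply]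
    rfl
  rw [map_zpow, h, ← map_zpow]
  change j ((rowAut φ ^ k.toAdd) (j.symm (j x))) = _
  rw [j.symm_apply_apply]
  rfl

/-- A positive real number with a power equal to `1` is `1`, so total positivity rules out torsion.
-/
theorem totallyPositiveUnits_zpow_injective {ε : totallyPositiveUnits ι θ} (hε : ε ≠ 1) :
    Function.Injective fun k : ℤ => ε ^ k := by
  rw [injective_zpow_iff_not_isOfFinOrder, isOfFinOrder_iff_pow_eq_one]
  rintro ⟨n, hn, h⟩
  apply hε
  have h1 : ι 0 (ε : (𝓞 K)ˣ) ^ n = 1 := by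
    have h2 : (((ε ^ n : totallyPositiveUnits ι θ) : (𝓞 K)ˣ) : K) = 1 := by
      rw [h]
      simp
    have h3 := congrArg (ι 0) h2
    simpa using h3
  rw [pow_eq_one_iff_of_nonneg (ε.2.2 0).le hn.ne'] at h1
  have h4 : (((ε : (𝓞 K)ˣ) : 𝓞 K) : K) = 1 := (ι 0).injective (h1.trans (map_one _).symm)
  refine Subtype.ext (Units.ext ?_)
  exact NumberField.RingOfIntegers.ext h4

end Quadratic

/-- Isomorphisms of semidirect products preserve twisted group C*-algebras. -/
theorem TwistedGroupCStar.nonempty_equiv_semidirect {N G N' G' : Type*} [Group N] [Group G]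
    [Group N'] [Group G'] {act : G →* MulAut N} {act' : G' →* MulAut N'}
    {σ : N → N → Circle} {τ : N' → N' → Circle} (hN : IsFolner N) (hG : IsFolner G)
    (hτ : IsMultiplier τ) (hact : ∀ g x y, τ (act' g x) (act' g y) = τ x y) (f : N ≃* N')
    (j : G ≃* G') (h : ∀ g x, f (act g x) = act' (j g) (f x))
    (hσ : ∀ x y, τ (f x) (f y) = σ x y) :
    Nonempty (TwistedGroupCStar (Γ := N ⋊[act] G) (semidirectTwist act σ) ≃⋆ₐ[ℂ]
      TwistedGroupCStar (Γ := N' ⋊[act'] G') (semidirectTwist act' τ)) := by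
  let e : N ⋊[act] G ≃* N' ⋊[act'] G' :=
    SemidirectProduct.congr f j fun g => MulEquiv.ext (h g)
  obtain ⟨q, -⟩ := exists_equiv (σ := semidirectTwist act σ) (hN.semidirectProduct hG act)
    (hτ.semidirectTwist act' hact) e fun x y => by
      change τ (f x.left) (act' (j x.right) (f y.left)) = σ x.left (act x.right y.left)
      rw [← h, hσ]
  exact ⟨q⟩

/-! ### Assembling the chain of isomorphisms -/

theorem mainTheorem10 {K : Type*} [Field K] [NumberField K] (hK : Module.finrank ℚ K = 2)
    (ι : Fin 2 → K →+* ℝ) (hι : Function.Injective ι)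
    (θ : K) (hθ : θ ∉ Set.range (algebraMap ℚ K))
    (V : Subgroup (totallyPositiveUnits ι θ)) (hV : V ≠ ⊥)
    (ε : totallyPositiveUnits ι θ) (hε : Subgroup.zpowers ε = V) :
    ∃ φ : Matrix.SpecialLinearGroup (Fin 2) ℤ,
      (((ε : (𝓞 K)ˣ) : K) = φ.1 0 0 + φ.1 0 1 * θ ∧
        ((ε : (𝓞 K)ˣ) : K) * θ = φ.1 1 0 + φ.1 1 1 * θ) ∧
      ∀ i : Fin 2, ∀ t u : ℝ, t = ι i θ → u = ι i θ * (ι 1 θ - ι 0 θ)⁻¹ →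
        ∃ (υT : V →* (NCTorus t ≃⋆ₐ[ℂ] NCTorus t))
          (υZ : Multiplicative ℤ →*
            (TwistedGroupCStar (sigmaZ t) ≃⋆ₐ[ℂ] TwistedGroupCStar (sigmaZ t)))
          (υΛ : V →*
            (TwistedGroupCStar (sigmaΛ ι θ u) ≃⋆ₐ[ℂ] TwistedGroupCStar (sigmaΛ ι θ u))),
          (∀ (w : V) (k : Multiplicative ℤ) (x : ZSq),
            (w : totallyPositiveUnits ι θ) = ε ^ k.toAdd →
              υT w (NCTorus.weyl t x) = NCTorus.weyl t (rowAction φ k x)) ∧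
          (∀ (k : Multiplicative ℤ) (x : ZSq),
            υZ k (TwistedGroupCStar.R (sigmaZ t) x) =
              TwistedGroupCStar.R (sigmaZ t) (rowAction φ k x)) ∧
          (∀ (w : V) (p : Multiplicative (latticeΛ ι θ)),
            υΛ w (TwistedGroupCStar.R (sigmaΛ ι θ u) p) =
              TwistedGroupCStar.R (sigmaΛ ι θ u) (unitAction ι θ w p)) ∧
          Nonempty (CrossedProduct υT ≃⋆ₐ[ℂ] CrossedProduct υZ) ∧
          Nonempty (CrossedProduct υZ ≃⋆ₐ[ℂ]
            TwistedGroupCStar (Γ := ZSq ⋊[rowAction φ] Multiplicative ℤ)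
              (semidirectTwist (rowAction φ) (sigmaZ t))) ∧
          Nonempty (CrossedProduct υZ ≃⋆ₐ[ℂ] CrossedProduct υΛ) ∧
          Nonempty (CrossedProduct υΛ ≃⋆ₐ[ℂ]
            TwistedGroupCStar (Γ := solvGroup ι θ V)
              (semidirectTwist ((unitAction ι θ).comp V.subtype) (sigmaΛ ι θ u))) := by
  have hne := embedding_apply_ne hK hι hθ
  obtain ⟨φ, h1, h2⟩ := exists_specialLinearGroup hne ε
  refine ⟨φ, ⟨h1, h2⟩, ?_⟩
  rintro i t u rfl rfl
  set t := ι i θ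
  set u := t * (ι 1 θ - ι 0 θ)⁻¹
  have hε1 : ε ≠ 1 := by
    rintro rfl
    exact hV (by rw [← hε, Subgroup.zpowers_one_eq_bot])
  have hinj := totallyPositiveUnits_zpow_injective hε1
  subst hε
  let j : Multiplicative ℤ ≃* Subgroup.zpowers ε :=
    MulEquiv.ofBijective (MonoidHom.mk'
      (fun k : Multiplicative ℤ => (⟨ε ^ k.toAdd, k.toAdd, rfl⟩ : Subgroup.zpowers ε))
      fun a b => Subtype.ext (zpow_add ε a.toAdd b.toAdd))
      ⟨fun a b h => hinj (congrArg Subtype.val h), fun ⟨_, k, hk⟩ => ⟨.ofAdd k, Subtype.ext hk⟩⟩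
  have hj : ∀ k, (j k : totallyPositiveUnits ι θ) = ε ^ k.toAdd := fun _ => rfl
  let f : ZSq ≃* Multiplicative (latticeΛ ι θ) :=
    MulEquiv.ofBijective (zSqToLattice ι θ) (zSqToLattice_bijective hθ)
  have hfσ : ∀ x y, sigmaΛ ι θ u (f x) (f y) = sigmaZ t x y := sigmaΛ_zSqToLattice hne t
  let actΛ := (unitAction ι θ).comp (Subgroup.zpowers ε).subtype
  have hfj : ∀ k x, f (rowAction φ k x) = actΛ (j k) (f x) := fun k x =>
    (unitAction_zpow_zSqToLattice hθ h1 h2 k x).symm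
  have hσZ := sigmaZ_isMultiplier t
  have hactZ := sigmaZ_rowAction t φ
  have hσΛ : IsMultiplier (sigmaΛ ι θ u) := hσZ.comp_mulEquiv f.symm fun x y => by
    rw [← hfσ, f.apply_symm_apply, f.apply_symm_apply]
  have hactΛ : ∀ w p q, sigmaΛ ι θ u (actΛ w p) (actΛ w q) = sigmaΛ ι θ u p q := by
    intro w p q
    obtain ⟨k, rfl⟩ := j.surjective w
    obtain ⟨x, rfl⟩ := f.surjective p
    obtain ⟨y, rfl⟩ := f.surjective q
    rw [← hfj, ← hfj, hfσ, hfσ, hactZ]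
  -- The row action is transported to `V` along `ε ^ k ↦ k`, so that the action on the torus comes
  -- from `C*(ℤ², σ_t)` through `e`.
  let actV : Subgroup.zpowers ε →* MulAut ZSq := (rowAction φ).comp j.symm.toMonoidHom
  have hactV : ∀ w x y, sigmaZ t (actV w x) (actV w y) = sigmaZ t x y := fun w => hactZ (j.symm w)
  have hFV : IsFolner (Subgroup.zpowers ε) := IsFolner.int.of_mulEquiv j
  have hFΛ : IsFolner (Multiplicative (latticeΛ ι θ)) := IsFolner.zSq.of_mulEquiv f
  obtain ⟨e, he⟩ := NCTorus.exists_equiv t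
  obtain ⟨υV, hυV⟩ := TwistedGroupCStar.exists_action IsFolner.zSq hσZ actV hactV
  obtain ⟨υZ, hυZ⟩ := TwistedGroupCStar.exists_action IsFolner.zSq hσZ (rowAction φ) hactZ
  obtain ⟨υΛ, hυΛ⟩ := TwistedGroupCStar.exists_action hFΛ hσΛ actΛ hactΛ
  let υT : Subgroup.zpowers ε →* (NCTorus t ≃⋆ₐ[ℂ] NCTorus t) :=
    MonoidHom.mk' (fun w => (e.symm.trans (υV w)).trans e) fun w z => by
      ext a
      change e (υV (w * z) (e.symm a)) = e (υV w (e.symm (e (υV z (e.symm a)))))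
      rw [StarAlgEquiv.symm_apply_apply, map_mul]
      rfl
  have hυT : ∀ w x, υT w (e (TwistedGroupCStar.R (sigmaZ t) x)) =
      e (TwistedGroupCStar.R (sigmaZ t) (actV w x)) := by
    intro w x
    change e (υV w (e.symm (e _))) = _
    rw [StarAlgEquiv.symm_apply_apply, hυV]
  -- `𝒜_t` lives one universe up, so covariant representations need a lifted copy of `ℤ² ⋊ V`.
  obtain ⟨qT⟩ := CrossedProduct.nonempty_equiv_twistedGroupCStar MulEquiv.ulift IsFolner.zSq hFV
    hσZ hactV e hυT
  obtain ⟨qZ⟩ := CrossedProduct.nonempty_equiv_twistedGroupCStar (MulEquiv.refl _) IsFolner.zSq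
    IsFolner.int hσZ hactZ (.refl ..) hυZ
  obtain ⟨qΛ⟩ := CrossedProduct.nonempty_equiv_twistedGroupCStar (MulEquiv.refl _) hFΛ hFV hσΛ
    hactΛ (.refl ..) hυΛ
  obtain ⟨qZV⟩ := TwistedGroupCStar.nonempty_equiv_semidirect (act := rowAction φ) (act' := actV)
    (σ := sigmaZ t) IsFolner.zSq IsFolner.int hσZ hactV (MulEquiv.refl _) j
    (fun k x => by
      change rowAction φ k x = rowAction φ (j.symm (j k)) x
      rw [j.symm_apply_apply]) fun _ _ => rfl
  obtain ⟨qZΛ⟩ := TwistedGroupCStar.nonempty_equiv_semidirect (act := rowAction φ) (act' := actΛ)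
    (σ := sigmaZ t) IsFolner.zSq IsFolner.int hσΛ hactΛ f j hfj hfσ
  refine ⟨υT, υZ, υΛ, ?_, hυZ, hυΛ, ⟨(qT.trans qZV.symm).trans qZ.symm⟩, ⟨qZ⟩,
    ⟨(qZ.trans qZΛ).trans qΛ.symm⟩, ⟨qΛ⟩⟩
  intro w k x hw
  have hwk : w = j k := Subtype.ext hw
  rw [← he, hυT, he, hwk]
  change NCTorus.weyl t (rowAction φ (j.symm (j k)) x) = _
  rw [j.symm_apply_apply]
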